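/- For $\kappa\in\mathbb C$ let $E_\kappa(z)=\exp(z+\kappa)$, let $F(t)=e^t-1$ for $t\ge 0$, and let $\sigma$ be the shift on sequences $\underline s=(s_1,s_2,\dots)$ of integers. Call $\underline s$ exponentially bounded if there is an $x>0$ with $|s_{k+1}|\le F^{\circ k}(x)$ for all $k\ge 0$, and let $t_{\underline s}=\inf\{x>0:\ \limsup_{n\to\infty}|s_n|/F^{\circ(n-1)}(x)=0\}$ be its minimal potential. For $j\in\mathbb Z$ let $L_{\kappa,j}(z)=\operatorname{Log} z-\kappa+2\pi i j$, with the principal logarithm. For exponentially bounded $\underline s$ and $t>t_{\underline s}$, the dynamic ray $g^\kappa_{\underline s}$ is defined at the potential $t$ if there is a continuous curve $g:[t,\infty)\to\mathbb C$ such that (i) for all sufficiently large $M$ and all $\tau\ge t$, $E_\kappa^{\circ M}(g(\tau))=\lim_{n\to\infty}L_{\kappa,s_{M+1}}\circ\cdots\circ L_{\kappa,s_{M+n}}(F^{\circ(M+n)}(\tau))$, and (ii) for every $k\ge 0$, $E_\kappa^{\circ k}(g(\tau))=F^{\circ k}(\tau)-\kappa+2\pi i s_{k+1}+o(1)$ as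 $\tau\to\infty$. Such a curve is unique, and $g^\kappa_{\underline s}(t):=g(t)$. For a $C^1$-curve $\gamma:(t_0,\infty)\to\mathbb C$ and a point $a\notin\gamma((t_0,\infty))$, the variation number of $\gamma$ around $a$ is $$\alpha(\gamma,a)=\frac1{2\pi}\int_{t_0}^\infty\left|\operatorname{Im}\frac{\gamma'(t)}{\gamma(t)-a}\right|dt\in[0,\infty].$$ **Proposition (Variation Number of Dynamic Rays).** Let $\kappa\in\mathbb C$, let $\underline s$ be an exponentially bounded sequence of integers, and let $z=g^\kappa_{\underline s}(t_0)$ be a point on the dynamic ray at address $\underline s$ with potential $t_0>t_{\underline s}$ (so the ray is defined at $t_0$). Suppose $N\in\{0,1,2,\dots\}$ is such that for all $t\ge F^{\circ N}(t_0)$ $$\left|\frac{(g^\kappa_{\sigma^N\underline s})''(t)}{(g^\kappa_{\sigma^N\underline s})'(t)}\right|<e^{-t/2}.$$ Then $g^\kappa_{\underline s}|_{(t_0,\infty)}$ is a $C^1$-curve which does not pass through $z$, and its variation number around $z$ satisfies $$\alpha\left(g^\kappa_{\underline s}|_{(t_0,\infty)},z\right)\le 2^N .$$ -/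

import Mathlib

open Set Filter Topology MeasureTheory

noncomputable section

namespace ExpRay

/-- The exponential map `E_κ(z) = exp (z + κ)`. -/
def expMap (κ z : ℂ) : ℂ := Complex.exp (z + κ)

/-- The model function for exponential growth, `F(t) = e^t - 1` (used for `t ≥ 0` only). -/
def modelF (t : ℝ) : ℝ := Real.exp t - 1

/-- The shift on sequences of integers. A sequence `s₁ s₂ s₃ …` is stored as
`s : ℕ → ℤ` with `s n` its entry of index `n + 1`. -/
def shift (s : ℕ → ℤ) : ℕ → ℤ := fun n => s (n + 1)

/-- `s` is exponentially bounded: there is `x > 0` with `|s_{k+1}| ≤ F^{∘k}(x)` for all `k`. -/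
def ExpBounded (s : ℕ → ℤ) : Prop :=
  ∃ x : ℝ, 0 < x ∧ ∀ k : ℕ, |(s k : ℝ)| ≤ modelF^[k] x

/-- The minimal potential `t_s`, the infimum of all `x > 0` such that
`|s_{n+1}| / F^{∘n}(x)` has limes superior (equivalently, limit) `0`. -/
def minPotential (s : ℕ → ℤ) : ℝ :=
  sInf {x : ℝ | 0 < x ∧ Tendsto (fun n : ℕ => |(s n : ℝ)| / modelF^[n] x) atTop (𝓝 0)}

/-- The inverse branch `L_{κ,j}(z) = Log z - κ + 2πij` of `E_κ`. -/
def invBranch (κ : ℂ) (j : ℤ) (z : ℂ) : ℂ :=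
  Complex.log z - κ + 2 * Real.pi * Complex.I * (j : ℂ)

/-- The approximation `L_{κ,s₁} ∘ ⋯ ∘ L_{κ,sₙ} (F^{∘n}(t))` of the dynamic ray at address `s`. -/
def rayApprox (κ : ℂ) : ℕ → (ℕ → ℤ) → ℝ → ℂ
  | 0, _, t => (t : ℂ)
  | n + 1, s, t => invBranch κ (s 0) (rayApprox κ n (shift s) (modelF t))

/-- `g` is, on `[t₀, ∞)`, the dynamic ray of `E_κ` at address `s`: the image of `g` under a high
iterate `E_κ^{∘N}` is a ray tail at address `σ^N s` (tails are the limits of the approximations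
`L_{κ,s_{N+1}} ∘ ⋯ ∘ L_{κ,s_{N+n}} ∘ F^{∘n}`), and `g` is obtained from this tail by pulling it
back `N` times along continuous branches of `E_κ⁻¹`, where the branches are fixed by the
asymptotics `t - κ + 2πi s_{k+1} + o(1)` of the ray at address `σ^k s`.
These conditions determine `g` on `[t₀, ∞)`, since two lifts of a curve under `exp` differ by a
constant in `2πiℤ`. -/
structure IsDynRayOn (κ : ℂ) (s : ℕ → ℤ) (t₀ : ℝ) (g : ℝ → ℂ) : Prop where
  continuousOn : ContinuousOn g (Ici t₀)
  tail : ∀ᶠ N : ℕ in atTop, ∀ t ∈ Ici t₀,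
    Tendsto (fun n : ℕ => rayApprox κ n (shift^[N] s) (modelF^[N] t)) atTop
      (𝓝 ((expMap κ)^[N] (g t)))
  asymptotics : ∀ k : ℕ,
    Tendsto (fun t : ℝ => (expMap κ)^[k] (g t)
      - (((modelF^[k] t : ℝ) : ℂ) - κ + 2 * Real.pi * Complex.I * (s k : ℂ))) atTop (𝓝 0)

/-- The dynamic ray at address `s` is defined at the potential `t > t_s`. (The only obstruction is
that, for some `n ≥ 1`, the ray at address `σ^n s` hits the omitted value `0` of `E_κ` at a
potential `≥ F^{∘n}(t)`, so that it cannot be pulled back further.) -/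
def RayDefinedAt (κ : ℂ) (s : ℕ → ℤ) (t : ℝ) : Prop :=
  minPotential s < t ∧ ∃ g : ℝ → ℂ, IsDynRayOn κ s t g

open Classical in
/-- The point `g_s^κ(t)` of potential `t` on the dynamic ray at address `s`
(with the value `0` where the ray is not defined). -/
def dynRay (κ : ℂ) (s : ℕ → ℤ) (t : ℝ) : ℂ :=
  if h : RayDefinedAt κ s t then h.2.choose t else 0

/-- The variation number of the curve `γ|_{(t₀,∞)}` around `a`, a value in `[0, ∞]`:
`(1/2π) ∫_{t₀}^∞ |Im (γ'(t) / (γ(t) - a))| dt`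
(for a `C¹`-curve on `(t₀,∞)` that does not pass through `a`). -/
def variationNumber (γ : ℝ → ℂ) (t₀ : ℝ) (a : ℂ) : ENNReal :=
  ENNReal.ofReal (1 / (2 * Real.pi)) *
    ∫⁻ t in Ioi t₀, ENNReal.ofReal |(deriv γ t / (γ t - a)).im|

end ExpRay

end

/-!
Beyond a point the ray is the uniform limit of its defining approximations. The logarithm of its
derivative is a series whose terms decay so fast that the series may be differentiated once more,
so the ray is there a `C²`-curve with nonzero derivative, close to a straight line. Pulling back
along `E_κ` extends this, and injectivity, to all of `(t₀, ∞)`.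

Two inequalities for the total variation `V` of the argument give the bound. If `l` is the
logarithmic derivative of `γ'`, then `w = γ' / (γ - a)` satisfies the Riccati equation
`w' = w (l - w)`. Hence `|arg w|` grows at most at the rate `|Im l| - |Im w|`, and since it lies in
`[0, π]`, this yields `V(γ - a) ≤ V(γ') + π`. For `η = exp ∘ γ` we have `γ' = η' / η`, so
`V(γ') ≤ V(η') + V(η) ≤ 2 V(η') + π`. Thus `V(γ') + π` at most doubles with each pullback, and after
`N` of them `V(γ - a) ≤ 2^N (V(γ_N') + π)`, where the smallness of `γ_N'' / γ_N'` makes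
`V(γ_N') ≤ ∫ e^{-t/2} dt ≤ 2 ≤ π`.
-/

noncomputable section

namespace ExpRay

/-! ### Variation of the argument along a curve -/

/-- The total variation of the argument of `γ` on `(t₀, ∞)`, in radians. Up to the unit, the
variation number of `γ` around `a` is the total variation of the argument of `γ - a`. -/
def argVariation (γ : ℝ → ℂ) (t₀ : ℝ) : ENNReal :=
  ∫⁻ t in Ioi t₀, ENNReal.ofReal |(logDeriv γ t).im|

/-- `γ` is a regular `C²`-curve on `(t₀, ∞)`, that is, it is `C²` with nowhere vanishing
derivative. -/
structure IsRegularCurve (γ : ℝ → ℂ) (t₀ : ℝ) : Prop where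
  contDiffOn : ContDiffOn ℝ 2 γ (Ioi t₀)
  deriv_ne_zero : ∀ t ∈ Ioi t₀, deriv γ t ≠ 0

theorem continuousAt_abs_arg {w : ℂ} (hw : w ≠ 0) : ContinuousAt (fun z : ℂ => |z.arg|) w := by
  have hangle : ContinuousAt (fun z : ℂ => InnerProductGeometry.angle 1 z) w :=
    (InnerProductGeometry.continuousAt_angle (x := ((1 : ℂ), w)) one_ne_zero hw).comp
      (f := fun z : ℂ => ((1 : ℂ), z)) (by fun_prop)
  refine hangle.congr ?_
  filter_upwards [isOpen_ne.mem_nhds hw] with z hz using Complex.angle_one_left hz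

section Slope

variable {w : ℝ → ℂ} {w' : ℂ} {t r : ℝ}

theorem hasDerivAt_arg (hw : HasDerivAt w w' t) (hs : w t ∈ Complex.slitPlane) :
    HasDerivAt (fun u => (w u).arg) (w' / w t).im t := by
  simpa only [Function.comp_def, Complex.imCLM_apply, Complex.log_im] using
    Complex.imCLM.hasFDerivAt.comp_hasDerivAt t (hw.clog_real hs)

theorem hasDerivAt_abs_arg_of_im_pos (hw : HasDerivAt w w' t) (him : 0 < (w t).im) :
    HasDerivAt (fun u => |(w u).arg|) (w' / w t).im t := by
  refine (hasDerivAt_arg hw (Or.inr him.ne')).congr_of_eventuallyEq ?_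
  filter_upwards [(Complex.continuous_im.continuousAt.comp hw.continuousAt).eventually_const_lt him]
    with u hu
  exact abs_of_nonneg (Complex.arg_nonneg_iff.2 (le_of_lt hu))

theorem hasDerivAt_abs_arg_of_im_neg (hw : HasDerivAt w w' t) (him : (w t).im < 0) :
    HasDerivAt (fun u => |(w u).arg|) (-(w' / w t).im) t := by
  refine (hasDerivAt_arg hw (Or.inr him.ne)).neg.congr_of_eventuallyEq ?_
  filter_upwards [(Complex.continuous_im.continuousAt.comp hw.continuousAt).eventually_lt_const him]
    with u hu
  exact abs_of_neg (Complex.arg_neg_iff.2 hu)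

theorem frequently_slope_abs_arg_lt_of_re_pos (hw : HasDerivAt w w' t) (hre : 0 < (w t).re)
    (hr : |(w' / w t).im| < r) : ∃ᶠ z in 𝓝[>] t, slope (fun u => |(w u).arg|) t z < r := by
  simpa only [slope_def_module, smul_eq_mul, Real.norm_eq_abs] using
    (hasDerivAt_arg hw (Or.inl hre)).hasDerivWithinAt.liminf_right_slope_norm_le hr

theorem frequently_slope_abs_arg_lt_of_arg_eq_pi (ht : (w t).arg = Real.pi) (hr : 0 < r) :
    ∃ᶠ z in 𝓝[>] t, slope (fun u => |(w u).arg|) t z < r := by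
  refine (eventually_mem_nhdsWithin.mono fun z hz => lt_of_le_of_lt ?_ hr).frequently
  rw [slope_def_field, ht, abs_of_pos Real.pi_pos]
  exact div_nonpos_of_nonpos_of_nonneg (sub_nonpos.2 (Complex.abs_arg_le_pi _))
    (sub_nonneg.2 (le_of_lt hz))

/-- If `w` is the logarithmic derivative of a curve `β`, then `w' = w (l - w)` where `l` is the
logarithmic derivative of `β'`. -/
theorem frequently_slope_abs_arg_lt {l : ℂ} (hw0 : w t ≠ 0)
    (hw : HasDerivAt w (w t * (l - w t)) t) (hr : |l.im| - |(w t).im| < r) :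
    ∃ᶠ z in 𝓝[>] t, slope (fun u => |(w u).arg|) t z < r := by
  have hlog : (w t * (l - w t) / w t).im = l.im - (w t).im := by
    rw [mul_div_cancel_left₀ _ hw0, Complex.sub_im]
  have habs := abs_le.1 (le_refl |l.im|)
  rcases lt_trichotomy (w t).im 0 with him | him | him
  · refine (hasDerivAt_abs_arg_of_im_neg hw him).hasDerivWithinAt.liminf_right_slope_le ?_
    rw [hlog]
    rw [abs_of_neg him] at hr
    linarith
  · rw [him, abs_zero, sub_zero] at hr
    rcases lt_or_gt_of_ne fun hre : (w t).re = 0 => hw0 (Complex.ext hre him) with hre | hre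
    · exact frequently_slope_abs_arg_lt_of_arg_eq_pi (Complex.arg_eq_pi_iff.2 ⟨hre, him⟩)
        ((abs_nonneg _).trans_lt hr)
    · refine frequently_slope_abs_arg_lt_of_re_pos hw hre ?_
      rwa [hlog, him, sub_zero]
  · refine (hasDerivAt_abs_arg_of_im_pos hw him).hasDerivWithinAt.liminf_right_slope_le ?_
    rw [hlog]
    rw [abs_of_pos him] at hr
    linarith

end Slope

theorem hasDerivWithinAt_Ici_integral {ψ : ℝ → ℝ} {x y t : ℝ} (hψ : ContinuousOn ψ (Icc x y))
    (ht : t ∈ Ico x y) : HasDerivWithinAt (fun u => ∫ v in x..u, ψ v) (ψ t) (Ici t) t := by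
  have hnhds : Icc x y ∈ 𝓝[>] t := mem_of_superset (Ioc_mem_nhdsGT ht.2) fun u hu =>
    ⟨ht.1.trans (le_of_lt hu.1), hu.2⟩
  refine intervalIntegral.integral_hasDerivWithinAt_right (t := Ioi t)
    (hψ.mono ?_).intervalIntegrable ⟨Icc x y, hnhds, hψ.aestronglyMeasurable measurableSet_Icc⟩
    ((hψ t (Ico_subset_Icc_self ht)).mono_of_mem_nhdsWithin hnhds)
  rw [uIcc_of_le ht.1]
  exact Icc_subset_Icc_right ht.2.le

theorem integral_abs_im_le {w l : ℝ → ℂ} {x y : ℝ} (hxy : x ≤ y) (hl : ContinuousOn l (Icc x y))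
    (hw0 : ∀ t ∈ Icc x y, w t ≠ 0)
    (hw : ∀ t ∈ Icc x y, HasDerivAt w (w t * (l t - w t)) t) :
    ∫ t in x..y, |(w t).im| ≤ (∫ t in x..y, |(l t).im|) + Real.pi := by
  have hwc : ContinuousOn w (Icc x y) := HasDerivAt.continuousOn hw
  have hli : ContinuousOn (fun t => |(l t).im|) (uIcc x y) := by
    rw [uIcc_of_le hxy]
    exact (Complex.continuous_im.comp_continuousOn hl).abs
  have hwi : ContinuousOn (fun t => |(w t).im|) (uIcc x y) := by
    rw [uIcc_of_le hxy]
    exact (Complex.continuous_im.comp_continuousOn hwc).abs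
  have hψ : ContinuousOn (fun t => |(l t).im| - |(w t).im|) (uIcc x y) := hli.sub hwi
  have hgrowth : |(w y).arg| ≤ |(w x).arg| + ∫ t in x..y, (|(l t).im| - |(w t).im|) := by
    refine image_le_of_liminf_slope_right_le_deriv_boundary
      (fun t ht => ((continuousAt_abs_arg (hw0 t ht)).comp
        (hw t ht).continuousAt).continuousWithinAt) (by simp) ?_
      (fun t ht => (hasDerivWithinAt_Ici_integral (uIcc_of_le hxy ▸ hψ) ht).const_add _)
      (fun t ht r hr => frequently_slope_abs_arg_lt (hw0 t (Ico_subset_Icc_self ht))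
        (hw t (Ico_subset_Icc_self ht)) hr) (right_mem_Icc.2 hxy)
    rw [← uIcc_of_le hxy]
    exact continuousOn_const.add
      (intervalIntegral.continuousOn_primitive_interval' hψ.intervalIntegrable left_mem_uIcc)
  rw [intervalIntegral.integral_sub hli.intervalIntegrable hwi.intervalIntegrable] at hgrowth
  linarith [Complex.abs_arg_le_pi (w x), abs_nonneg (w y).arg]

theorem lintegral_Ioi_le_of_forall_Ioc {f : ℝ → ENNReal} {t₀ : ℝ} {C : ENNReal}
    (hf : AEMeasurable f (volume.restrict (Ioi t₀)))
    (h : ∀ x y, t₀ < x → x ≤ y → ∫⁻ t in Ioc x y, f t ≤ C) : ∫⁻ t in Ioi t₀, f t ≤ C := by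
  have hlim : Tendsto (fun n : ℕ => t₀ + 1 / ((n : ℝ) + 1)) atTop (𝓝 t₀) := by
    simpa using tendsto_one_div_add_atTop_nhds_zero_nat.const_add t₀
  have hcover := (aecover_Ioi_of_Ioi (μ := volume) hlim).inter
    (aecover_Iic tendsto_natCast_atTop_atTop).restrict
  refine le_of_tendsto' (hcover.lintegral_tendsto_of_nat hf) fun n => ?_
  have hn : t₀ < t₀ + 1 / ((n : ℝ) + 1) := lt_add_of_pos_right _ Nat.one_div_pos_of_nat
  rw [Ioi_inter_Iic, Measure.restrict_restrict_of_subset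
    (Ioc_subset_Ioi_self.trans (Ioi_subset_Ioi hn.le))]
  rcases le_or_gt (t₀ + 1 / ((n : ℝ) + 1)) n with hle | hlt
  · exact h _ _ hn hle
  · rw [Ioc_eq_empty_of_le hlt.le, Measure.restrict_empty, lintegral_zero_measure]
    exact zero_le

theorem lintegral_Ioc_ofReal_abs_im {w : ℝ → ℂ} {x y : ℝ} (hxy : x ≤ y)
    (hw : ContinuousOn w (Icc x y)) :
    ∫⁻ t in Ioc x y, ENNReal.ofReal |(w t).im| = ENNReal.ofReal (∫ t in x..y, |(w t).im|) := by
  have hint : IntegrableOn (fun t => |(w t).im|) (Ioc x y) :=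
    (Complex.continuous_im.comp_continuousOn hw).abs.integrableOn_Icc.mono_set Ioc_subset_Icc_self
  rw [intervalIntegral.integral_of_le hxy, ofReal_integral_eq_lintegral_ofReal hint
    (Eventually.of_forall fun _ => abs_nonneg _)]

section Curve

variable {γ γ₁ γ₂ : ℝ → ℂ} {t₀ : ℝ}

theorem argVariation_congr (h : EqOn γ₁ γ₂ (Ioi t₀)) :
    argVariation γ₁ t₀ = argVariation γ₂ t₀ :=
  setLIntegral_congr_fun measurableSet_Ioi fun t ht => by
    simp only [logDeriv_apply, h ht, (h.eventuallyEq_of_mem (Ioi_mem_nhds ht)).deriv_eq]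

theorem aemeasurable_argVariation (h : ContinuousOn (logDeriv γ) (Ioi t₀)) :
    AEMeasurable (fun t => ENNReal.ofReal |(logDeriv γ t).im|) (volume.restrict (Ioi t₀)) :=
  ((Complex.continuous_im.comp_continuousOn h).abs.aemeasurable measurableSet_Ioi).ennreal_ofReal

theorem continuousOn_logDeriv (h : ContDiffOn ℝ 1 γ (Ioi t₀)) (h0 : ∀ t ∈ Ioi t₀, γ t ≠ 0) :
    ContinuousOn (logDeriv γ) (Ioi t₀) :=
  (h.continuousOn_deriv_of_isOpen isOpen_Ioi le_rfl).div h.continuousOn h0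

theorem argVariation_div_le (h₁ : ContDiffOn ℝ 1 γ₁ (Ioi t₀)) (h₂ : ContDiffOn ℝ 1 γ₂ (Ioi t₀))
    (h₁0 : ∀ t ∈ Ioi t₀, γ₁ t ≠ 0) (h₂0 : ∀ t ∈ Ioi t₀, γ₂ t ≠ 0) :
    argVariation (fun t => γ₁ t / γ₂ t) t₀ ≤ argVariation γ₁ t₀ + argVariation γ₂ t₀ := by
  rw [argVariation, argVariation, argVariation,
    ← lintegral_add_left' (aemeasurable_argVariation (continuousOn_logDeriv h₁ h₁0))]
  refine setLIntegral_mono' measurableSet_Ioi fun t ht => ?_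
  rw [logDeriv_div t (h₁0 t ht) (h₂0 t ht)
    ((h₁.contDiffAt (Ioi_mem_nhds ht)).differentiableAt one_ne_zero)
    ((h₂.contDiffAt (Ioi_mem_nhds ht)).differentiableAt one_ne_zero), Complex.sub_im,
    ← ENNReal.ofReal_add (abs_nonneg _) (abs_nonneg _)]
  exact ENNReal.ofReal_le_ofReal (abs_sub _ _)

theorem argVariation_smul {r : ℝ → ℝ} (hr : ∀ t ∈ Ioi t₀, DifferentiableAt ℝ r t)
    (hr0 : ∀ t ∈ Ioi t₀, r t ≠ 0) (hγ : ∀ t ∈ Ioi t₀, DifferentiableAt ℝ γ t)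
    (hγ0 : ∀ t ∈ Ioi t₀, γ t ≠ 0) :
    argVariation (fun t => r t • γ t) t₀ = argVariation γ t₀ := by
  refine setLIntegral_congr_fun measurableSet_Ioi fun t ht => ?_
  have hlog : logDeriv (fun t => r t • γ t) t = (logDeriv r t : ℝ) + logDeriv γ t := by
    have hr0' : (r t : ℂ) ≠ 0 := Complex.ofReal_ne_zero.2 (hr0 t ht)
    have hγ0' := hγ0 t ht
    rw [logDeriv_apply, deriv_fun_smul (hr t ht) (hγ t ht)]
    simp only [logDeriv_apply, Complex.real_smul, Complex.ofReal_div]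
    field_simp
    ring
  simp only [hlog, Complex.add_im, Complex.ofReal_im, zero_add]

theorem argVariation_comp {φ φ' : ℝ → ℝ} {t₁ : ℝ} (hφ : ∀ t ∈ Ioi t₀, HasDerivAt φ (φ' t) t)
    (hinj : InjOn φ (Ioi t₀)) (himage : φ '' Ioi t₀ = Ioi t₁)
    (hγ : ∀ t ∈ Ioi t₁, DifferentiableAt ℝ γ t) :
    argVariation (fun t => γ (φ t)) t₀ = argVariation γ t₁ := by
  rw [argVariation, argVariation, ← himage, lintegral_image_eq_lintegral_abs_deriv_mul
    measurableSet_Ioi (fun t ht => (hφ t ht).hasDerivWithinAt) hinj]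
  refine setLIntegral_congr_fun measurableSet_Ioi fun t ht => ?_
  have hderiv := (hγ (φ t) (himage.subset ⟨t, ht, rfl⟩)).hasDerivAt.scomp t (hφ t ht)
  simp only [logDeriv_apply, Function.comp_def] at hderiv ⊢
  rw [hderiv.deriv, smul_div_assoc, Complex.smul_im, smul_eq_mul, abs_mul,
    ENNReal.ofReal_mul (abs_nonneg _)]

theorem IsRegularCurve.congr (h : IsRegularCurve γ₁ t₀) (heq : EqOn γ₂ γ₁ (Ioi t₀)) :
    IsRegularCurve γ₂ t₀ where
  contDiffOn := h.contDiffOn.congr heq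
  deriv_ne_zero t ht := by
    rw [(heq.eventuallyEq_of_mem (Ioi_mem_nhds ht)).deriv_eq]
    exact h.deriv_ne_zero t ht

theorem IsRegularCurve.sub_const (h : IsRegularCurve γ t₀) (a : ℂ) :
    IsRegularCurve (fun t => γ t - a) t₀ where
  contDiffOn := h.contDiffOn.sub contDiffOn_const
  deriv_ne_zero t ht := by
    rw [deriv_sub_const_fun]
    exact h.deriv_ne_zero t ht

theorem IsRegularCurve.differentiableAt (h : IsRegularCurve γ t₀) {t : ℝ} (ht : t ∈ Ioi t₀) :
    DifferentiableAt ℝ γ t :=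
  (h.contDiffOn.contDiffAt (Ioi_mem_nhds ht)).differentiableAt two_ne_zero

theorem IsRegularCurve.contDiffOn_deriv (h : IsRegularCurve γ t₀) :
    ContDiffOn ℝ 1 (deriv γ) (Ioi t₀) :=
  h.contDiffOn.deriv_of_isOpen isOpen_Ioi (by norm_num)

theorem IsRegularCurve.differentiableAt_deriv (h : IsRegularCurve γ t₀) {t : ℝ}
    (ht : t ∈ Ioi t₀) : DifferentiableAt ℝ (deriv γ) t :=
  (h.contDiffOn_deriv.contDiffAt (Ioi_mem_nhds ht)).differentiableAt one_ne_zero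

theorem IsRegularCurve.comp (h : IsRegularCurve γ t₀) {φ : ℝ → ℝ} {t₁ : ℝ}
    (hφ : ContDiffOn ℝ 2 φ (Ioi t₁)) (hφ0 : ∀ t ∈ Ioi t₁, deriv φ t ≠ 0)
    (hmaps : MapsTo φ (Ioi t₁) (Ioi t₀)) : IsRegularCurve (fun t => γ (φ t)) t₁ where
  contDiffOn := h.contDiffOn.comp hφ hmaps
  deriv_ne_zero t ht := by
    have hφt := (hφ.contDiffAt (Ioi_mem_nhds ht)).differentiableAt two_ne_zero
    have hγφ := (h.differentiableAt (hmaps ht)).hasDerivAt.scomp t hφt.hasDerivAt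
    rw [Function.comp_def] at hγφ
    rw [hγφ.deriv]
    exact smul_ne_zero (hφ0 t ht) (h.deriv_ne_zero _ (hmaps ht))

theorem IsRegularCurve.hasDerivAt_logDeriv_sub (h : IsRegularCurve γ t₀) {a : ℂ} {t : ℝ}
    (ht : t ∈ Ioi t₀) (ha : γ t ≠ a) :
    HasDerivAt (logDeriv fun t => γ t - a) (logDeriv (fun t => γ t - a) t *
      (logDeriv (deriv γ) t - logDeriv (fun t => γ t - a) t)) t := by
  have hquot := (h.differentiableAt_deriv ht).hasDerivAt.div
    ((h.differentiableAt ht).hasDerivAt.sub_const a) (sub_ne_zero.2 ha)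
  have hlog : logDeriv (fun t => γ t - a) = deriv γ / fun t => γ t - a := by
    ext u
    simp only [logDeriv_apply, deriv_sub_const_fun, Pi.div_apply]
  rw [hlog]
  refine hquot.congr_deriv ?_
  have := sub_ne_zero.2 ha
  have := h.deriv_ne_zero t ht
  simp only [logDeriv_apply, Pi.div_apply]
  field_simp

theorem IsRegularCurve.argVariation_sub_const_le (h : IsRegularCurve γ t₀) {a : ℂ}
    (ha : a ∉ γ '' Ioi t₀) :
    argVariation (fun t => γ t - a) t₀ ≤ argVariation (deriv γ) t₀ + ENNReal.ofReal Real.pi := by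
  have ha' : ∀ t ∈ Ioi t₀, γ t ≠ a := fun t ht hta => ha ⟨t, ht, hta⟩
  have hw := fun t ht => h.hasDerivAt_logDeriv_sub (a := a) ht (ha' t ht)
  have hwc := HasDerivAt.continuousOn hw
  have hlc := continuousOn_logDeriv h.contDiffOn_deriv h.deriv_ne_zero
  refine lintegral_Ioi_le_of_forall_Ioc (aemeasurable_argVariation hwc) fun x y hx hxy => ?_
  have hsub : Icc x y ⊆ Ioi t₀ := fun t ht => hx.trans_le ht.1
  have hw0 : ∀ t ∈ Icc x y, logDeriv (fun t => γ t - a) t ≠ 0 := fun t ht => by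
    rw [logDeriv_apply, deriv_sub_const_fun]
    exact div_ne_zero (h.deriv_ne_zero t (hsub ht)) (sub_ne_zero.2 (ha' t (hsub ht)))
  calc ∫⁻ t in Ioc x y, ENNReal.ofReal |(logDeriv (fun t => γ t - a) t).im|
      ≤ ENNReal.ofReal ((∫ t in x..y, |(logDeriv (deriv γ) t).im|) + Real.pi) := by
        rw [lintegral_Ioc_ofReal_abs_im hxy (hwc.mono hsub)]
        exact ENNReal.ofReal_le_ofReal
          (integral_abs_im_le hxy (hlc.mono hsub) hw0 fun t ht => hw t (hsub ht))
    _ ≤ (∫⁻ t in Ioc x y, ENNReal.ofReal |(logDeriv (deriv γ) t).im|) + ENNReal.ofReal Real.pi := by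
        rw [lintegral_Ioc_ofReal_abs_im hxy (hlc.mono hsub)]
        exact ENNReal.ofReal_add_le
    _ ≤ argVariation (deriv γ) t₀ + ENNReal.ofReal Real.pi := by
        gcongr
        exact lintegral_mono_set (Ioc_subset_Icc_self.trans hsub)

theorem IsRegularCurve.hasDerivAt_cexp (h : IsRegularCurve γ t₀) {t : ℝ} (ht : t ∈ Ioi t₀) :
    HasDerivAt (fun t => Complex.exp (γ t)) (Complex.exp (γ t) * deriv γ t) t :=
  (h.differentiableAt ht).hasDerivAt.cexp

theorem IsRegularCurve.cexp (h : IsRegularCurve γ t₀) :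
    IsRegularCurve (fun t => Complex.exp (γ t)) t₀ where
  contDiffOn := h.contDiffOn.cexp
  deriv_ne_zero t ht := by
    rw [(h.hasDerivAt_cexp ht).deriv]
    exact mul_ne_zero (Complex.exp_ne_zero _) (h.deriv_ne_zero t ht)

/-- Since `γ' = η' / η` for `η = exp ∘ γ`, the argument of `γ'` varies at most as much as those
of `η'` and `η` together. -/
theorem IsRegularCurve.argVariation_deriv_le (h : IsRegularCurve γ t₀) :
    argVariation (deriv γ) t₀ ≤
      2 * argVariation (deriv fun t => Complex.exp (γ t)) t₀ + ENNReal.ofReal Real.pi := by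
  have hη := h.cexp
  have hquot : EqOn (deriv γ) (fun t => deriv (fun t => Complex.exp (γ t)) t / Complex.exp (γ t))
      (Ioi t₀) := fun t ht => by
    simp only [(h.hasDerivAt_cexp ht).deriv, mul_div_cancel_left₀ _ (Complex.exp_ne_zero _)]
  have hη0 := hη.argVariation_sub_const_le (a := 0) fun ⟨t, _, ht⟩ => Complex.exp_ne_zero _ ht
  simp only [sub_zero] at hη0
  rw [argVariation_congr hquot, two_mul, add_assoc]
  exact (argVariation_div_le hη.contDiffOn_deriv (hη.contDiffOn.of_le one_le_two) hη.deriv_ne_zero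
    fun _ _ => Complex.exp_ne_zero _).trans (by gcongr)

theorem variationNumber_eq (γ : ℝ → ℂ) (t₀ : ℝ) (a : ℂ) :
    variationNumber γ t₀ a =
      argVariation (fun t => γ t - a) t₀ / ENNReal.ofReal (2 * Real.pi) := by
  simp only [variationNumber, argVariation, logDeriv_apply, deriv_sub_const_fun]
  rw [one_div, ENNReal.ofReal_inv_of_pos Real.two_pi_pos, ENNReal.div_eq_inv_mul]

end Curve

/-! ### Lifts under the exponential map -/

theorem eqOn_of_cexp_eq {f g : ℝ → ℂ} {t₀ : ℝ} (hf : ContinuousOn f (Ici t₀))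
    (hg : ContinuousOn g (Ici t₀))
    (hexp : ∀ t ∈ Ici t₀, Complex.exp (f t) = Complex.exp (g t))
    (hlim : Tendsto (fun t => f t - g t) atTop (𝓝 0)) : EqOn f g (Ici t₀) := by
  obtain ⟨T, hclose, hT⟩ := ((hlim.norm.eventually_lt_const (u := Real.pi)
    (by simpa using Real.pi_pos)).and (eventually_ge_atTop t₀)).exists
  have him := abs_lt.1 ((Complex.abs_im_le_norm _).trans_lt hclose)
  have hone : Complex.exp (f T - g T) = 1 := by
    rw [Complex.exp_sub, hexp T hT, div_self (Complex.exp_ne_zero _)]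
  have hagree : f T = g T := by
    rw [← sub_eq_zero, ← Complex.log_exp him.1 him.2.le, hone, Complex.log_one]
  exact Complex.isCoveringMap_exp.eqOn_of_comp_eqOn isPreconnected_Ici hf hg
    (fun t ht => Subtype.ext (hexp t ht)) hT hagree

theorem contDiffOn_of_cexp {f : ℝ → ℂ} {U : Set ℝ} {n : WithTop ℕ∞} (hU : IsOpen U)
    (hf : ContinuousOn f U) (hexp : ContDiffOn ℝ n (fun t => Complex.exp (f t)) U) :
    ContDiffOn ℝ n f U := by
  intro t ht
  have hclose : ∀ᶠ u in 𝓝 t, ‖f u - f t‖ < Real.pi :=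
    ((hf.continuousAt (hU.mem_nhds ht)).sub_const (f t)).norm.eventually_lt_const
      (by simpa using Real.pi_pos)
  have hlog : f =ᶠ[𝓝 t] fun u => f t + Complex.log (Complex.exp (f u) / Complex.exp (f t)) := by
    filter_upwards [hclose] with u hu
    have him := abs_lt.1 ((Complex.abs_im_le_norm _).trans_lt hu)
    rw [← Complex.exp_sub, Complex.log_exp him.1 him.2.le, add_sub_cancel]
  have hquot : ContDiffAt ℝ n (fun u => Complex.exp (f u) / Complex.exp (f t)) t :=
    (hexp.contDiffAt (hU.mem_nhds ht)).div_const _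
  have hdiff : ContDiffAt ℝ n Complex.log (Complex.exp (f t) / Complex.exp (f t)) := by
    rw [div_self (Complex.exp_ne_zero _)]
    exact (Complex.contDiffAt_log Complex.one_mem_slitPlane).restrict_scalars ℝ
  exact (ContDiffAt.congr_of_eventuallyEq (contDiffAt_const.add (hdiff.comp t hquot))
    hlog).contDiffWithinAt

theorem IsRegularCurve.of_cexp {γ : ℝ → ℂ} {t₀ : ℝ} (hγ : ContinuousOn γ (Ioi t₀))
    (h : IsRegularCurve (fun t => Complex.exp (γ t)) t₀) : IsRegularCurve γ t₀ where
  contDiffOn := contDiffOn_of_cexp isOpen_Ioi hγ h.contDiffOn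
  deriv_ne_zero t ht h0 := by
    have hdiff := (contDiffOn_of_cexp isOpen_Ioi hγ h.contDiffOn).contDiffAt (Ioi_mem_nhds ht)
    refine h.deriv_ne_zero t ht ?_
    rw [(hdiff.differentiableAt two_ne_zero).hasDerivAt.cexp.deriv, h0, mul_zero]

/-! ### Iteration of the model map -/

theorem modelF_strictMono : StrictMono modelF := fun _ _ h =>
  sub_lt_sub_right (Real.exp_lt_exp.2 h) 1

theorem modelF_add_one (t : ℝ) : modelF t + 1 = Real.exp t := sub_add_cancel _ _

theorem le_modelF (t : ℝ) : t ≤ modelF t := le_sub_iff_add_le.2 (Real.add_one_le_exp t)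

theorem add_sq_div_two_le_modelF {t : ℝ} (ht : 0 ≤ t) : t + t ^ 2 / 2 ≤ modelF t := by
  have := Real.quadratic_le_exp_of_nonneg ht
  simp only [modelF]
  linarith

theorem contDiff_modelF {n : WithTop ℕ∞} : ContDiff ℝ n modelF :=
  Real.contDiff_exp.sub contDiff_const

theorem continuous_modelF : Continuous modelF := contDiff_modelF.continuous (n := 0)

theorem hasDerivAt_modelF (t : ℝ) : HasDerivAt modelF (Real.exp t) t :=
  (Real.hasDerivAt_exp t).sub_const 1

theorem exists_modelF_eq {t₀ u : ℝ} (hu : modelF t₀ ≤ u) : ∃ t, t₀ ≤ t ∧ modelF t = u := by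
  have hexp : Real.exp t₀ ≤ u + 1 := modelF_add_one t₀ ▸ add_le_add_left hu 1
  have hpos := (Real.exp_pos t₀).trans_le hexp
  exact ⟨Real.log (u + 1), (Real.le_log_iff_exp_le hpos).2 hexp, by
    rw [modelF, Real.exp_log hpos, add_sub_cancel_right]⟩

theorem image_modelF_Ioi (t₀ : ℝ) : modelF '' Ioi t₀ = Ioi (modelF t₀) := by
  refine Subset.antisymm (image_subset_iff.2 fun t ht => modelF_strictMono ht) fun u hu => ?_
  obtain ⟨t, -, rfl⟩ := exists_modelF_eq (le_of_lt hu)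
  exact ⟨t, modelF_strictMono.lt_iff_lt.1 hu, rfl⟩

theorem strictMono_iterate_modelF (n : ℕ) : StrictMono modelF^[n] := modelF_strictMono.iterate n

theorem continuous_iterate_modelF (n : ℕ) : Continuous modelF^[n] := continuous_modelF.iterate n

theorem le_iterate_modelF (n : ℕ) (t : ℝ) : t ≤ modelF^[n] t :=
  Function.id_le_iterate_of_id_le le_modelF n t

theorem exists_iterate_modelF_eq {t₀ u : ℝ} {n : ℕ} (hu : modelF^[n] t₀ ≤ u) :
    ∃ t, t₀ ≤ t ∧ modelF^[n] t = u := by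
  induction n generalizing u with
  | zero => exact ⟨u, hu, rfl⟩
  | succ n ih =>
    simp only [Function.iterate_succ_apply'] at hu ⊢
    obtain ⟨v, hv, rfl⟩ := exists_modelF_eq hu
    obtain ⟨t, ht, rfl⟩ := ih hv
    exact ⟨t, ht, rfl⟩

theorem add_mul_le_iterate_modelF {t : ℝ} (ht : 0 ≤ t) (n : ℕ) :
    t + n * (t ^ 2 / 2) ≤ modelF^[n] t := by
  induction n with
  | zero => simp
  | succ n ih =>
    rw [Function.iterate_succ_apply']
    have hle := le_iterate_modelF n t
    have hstep := add_sq_div_two_le_modelF (ht.trans hle)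
    push_cast
    nlinarith

theorem tendsto_iterate_modelF {t : ℝ} (ht : 0 < t) :
    Tendsto (fun n => modelF^[n] t) atTop atTop :=
  tendsto_atTop_mono (add_mul_le_iterate_modelF ht.le) (tendsto_atTop_add_const_left _ _
    (tendsto_natCast_atTop_atTop.atTop_mul_const (by positivity)))

theorem mul_sub_le_modelF_sub {a b c : ℝ} (hca : c ≤ a) (hab : a ≤ b) :
    (1 + c) * (b - a) ≤ modelF b - modelF a := by
  have hexp : Real.exp b = Real.exp a * Real.exp (b - a) := by rw [← Real.exp_add]; ring_nf
  calc (1 + c) * (b - a) ≤ Real.exp a * (Real.exp (b - a) - 1) :=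
        mul_le_mul (by linarith [Real.add_one_le_exp a])
          (by linarith [Real.add_one_le_exp (b - a)]) (sub_nonneg.2 hab) (Real.exp_pos _).le
    _ = modelF b - modelF a := by simp only [modelF, hexp]; ring

theorem pow_mul_sub_le_iterate_modelF_sub {x t : ℝ} (hx : 0 ≤ x) (hxt : x ≤ t) (n : ℕ) :
    (1 + x) ^ n * (t - x) ≤ modelF^[n] t - modelF^[n] x := by
  induction n with
  | zero => simp
  | succ n ih =>
    rw [Function.iterate_succ_apply', Function.iterate_succ_apply', pow_succ', mul_assoc]
    exact (mul_le_mul_of_nonneg_left ih (by linarith)).trans (mul_sub_le_modelF_sub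
      (le_iterate_modelF n x) ((strictMono_iterate_modelF n).monotone hxt))

theorem tendsto_iterate_modelF_sub {x t : ℝ} (hx : 0 < x) (hxt : x < t) :
    Tendsto (fun n => modelF^[n] t - modelF^[n] x) atTop atTop :=
  tendsto_atTop_mono (pow_mul_sub_le_iterate_modelF_sub hx.le hxt.le)
    ((tendsto_pow_atTop_atTop_of_one_lt (by linarith)).atTop_mul_const (sub_pos.2 hxt))

theorem modelF_div_le {a b : ℝ} (hb : 0 < b) (hab : a ≤ b) :
    modelF a / modelF b ≤ Real.exp (-(b - a)) := by
  have hexp : Real.exp (-(b - a)) * Real.exp b = Real.exp a := by rw [← Real.exp_add]; ring_nf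
  have hone : Real.exp (-(b - a)) ≤ 1 := Real.exp_le_one_iff.2 (by linarith)
  rw [div_le_iff₀ (hb.trans_le (le_modelF b))]
  simp only [modelF]
  linarith

theorem tendsto_iterate_modelF_div {x t : ℝ} (hx : 0 < x) (hxt : x < t) :
    Tendsto (fun n => modelF^[n] x / modelF^[n] t) atTop (𝓝 0) := by
  have hpos : ∀ {y : ℝ}, 0 < y → ∀ n, 0 < modelF^[n] y := fun hy n =>
    hy.trans_le (le_iterate_modelF n _)
  rw [← tendsto_add_atTop_iff_nat 1]
  refine squeeze_zero (fun n => (div_pos (hpos hx _) (hpos (hx.trans hxt) _)).le) (fun n => ?_)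
    (Real.tendsto_exp_neg_atTop_nhds_zero.comp (tendsto_iterate_modelF_sub hx hxt))
  rw [Function.iterate_succ_apply', Function.iterate_succ_apply']
  exact modelF_div_le (hpos (hx.trans hxt) n) ((strictMono_iterate_modelF n).monotone hxt.le)

/-- The sum `t + F(t) + ⋯ + F^{∘(n-1)}(t)`, which is the logarithm of the derivative of `F^{∘n}`
at `t`. -/
def orbitSum (n : ℕ) (t : ℝ) : ℝ := ∑ i ∈ Finset.range n, modelF^[i] t

@[simp] theorem orbitSum_zero (t : ℝ) : orbitSum 0 t = 0 := Finset.sum_range_zero _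

theorem orbitSum_succ (n : ℕ) (t : ℝ) : orbitSum (n + 1) t = orbitSum n t + modelF^[n] t :=
  Finset.sum_range_succ _ n

theorem orbitSum_succ' (n : ℕ) (t : ℝ) : orbitSum (n + 1) t = orbitSum n (modelF t) + t :=
  Finset.sum_range_succ' _ n

theorem monotone_orbitSum {t : ℝ} (ht : 0 ≤ t) : Monotone fun n => orbitSum n t :=
  monotone_nat_of_le_succ fun n =>
    (orbitSum_succ n t).symm ▸ le_add_of_nonneg_right (ht.trans (le_iterate_modelF n t))

theorem exp_neg_orbitSum_le_one {t : ℝ} (ht : 0 ≤ t) (n : ℕ) : Real.exp (-orbitSum n t) ≤ 1 :=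
  Real.exp_le_one_iff.2 <| neg_nonpos.2 <|
    (orbitSum_zero t).ge.trans (monotone_orbitSum ht n.zero_le)

theorem continuous_orbitSum (n : ℕ) : Continuous (orbitSum n) :=
  continuous_finsetSum _ fun i _ => continuous_iterate_modelF i

theorem hasDerivAt_iterate_modelF (n : ℕ) (t : ℝ) :
    HasDerivAt modelF^[n] (Real.exp (orbitSum n t)) t := by
  induction n with
  | zero => simpa using hasDerivAt_id t
  | succ n ih =>
    rw [Function.iterate_succ', orbitSum_succ, add_comm, Real.exp_add]
    exact (hasDerivAt_modelF _).comp t ih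

theorem two_mul_orbitSum_add_le {t : ℝ} (ht : 10 ≤ t) (n : ℕ) :
    2 * (orbitSum n t + n + 2) ≤ modelF^[n] t := by
  induction n with
  | zero => simp; linarith
  | succ n ih =>
    rw [orbitSum_succ, Function.iterate_succ_apply']
    have hten := ht.trans (le_iterate_modelF n t)
    have hstep := add_sq_div_two_le_modelF (t := modelF^[n] t) (by linarith)
    push_cast
    nlinarith

theorem two_pow_mul_exp_orbitSum_le {t : ℝ} (ht : 10 ≤ t) (n : ℕ) :
    4 * 2 ^ n * Real.exp (orbitSum n t) * Real.exp (modelF^[n] t / 2) ≤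
      Real.exp (modelF^[n] t) := by
  have hpow : 4 * (2 : ℝ) ^ n ≤ Real.exp (n + 2) :=
    calc 4 * (2 : ℝ) ^ n = 2 ^ (n + 2) := by ring
      _ ≤ Real.exp 1 ^ (n + 2) := by gcongr; linarith [Real.add_one_le_exp (1 : ℝ)]
      _ = Real.exp (n + 2) := by rw [← Real.exp_nat_mul]; push_cast; ring_nf
  calc 4 * 2 ^ n * Real.exp (orbitSum n t) * Real.exp (modelF^[n] t / 2)
      ≤ Real.exp (n + 2) * Real.exp (orbitSum n t) * Real.exp (modelF^[n] t / 2) := by gcongr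
    _ = Real.exp (n + 2 + orbitSum n t + modelF^[n] t / 2) := by simp only [Real.exp_add]
    _ ≤ Real.exp (modelF^[n] t) := Real.exp_le_exp.2 (by linarith [two_mul_orbitSum_add_le ht n])

theorem IsRegularCurve.comp_modelF {γ : ℝ → ℂ} {t₀ : ℝ} (h : IsRegularCurve γ (modelF t₀)) :
    IsRegularCurve (fun t => γ (modelF t)) t₀ :=
  h.comp contDiff_modelF.contDiffOn
    (fun t _ => (hasDerivAt_modelF t).deriv.trans_ne (Real.exp_ne_zero t))
    fun _ ht => modelF_strictMono ht

theorem IsRegularCurve.argVariation_deriv_comp_modelF {γ : ℝ → ℂ} {t₀ : ℝ}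
    (h : IsRegularCurve γ (modelF t₀)) :
    argVariation (deriv fun t => γ (modelF t)) t₀ = argVariation (deriv γ) (modelF t₀) := by
  have hmaps : ∀ {t}, t ∈ Ioi t₀ → modelF t ∈ Ioi (modelF t₀) := fun ht => modelF_strictMono ht
  have hchain : EqOn (deriv fun t => γ (modelF t))
      (fun t => Real.exp t • deriv γ (modelF t)) (Ioi t₀) := fun t ht =>
    ((h.differentiableAt (hmaps ht)).hasDerivAt.scomp t (hasDerivAt_modelF t)).deriv
  rw [argVariation_congr hchain, argVariation_smul (γ := fun t => deriv γ (modelF t))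
    (fun t _ => Real.differentiableAt_exp) (fun t _ => Real.exp_ne_zero t)
    (fun t ht =>
      (h.differentiableAt_deriv (hmaps ht)).comp t (hasDerivAt_modelF t).differentiableAt)
    (fun t ht => h.deriv_ne_zero _ (hmaps ht)),
    argVariation_comp (fun t _ => hasDerivAt_modelF t) modelF_strictMono.injective.injOn
      (image_modelF_Ioi t₀) (fun t ht => h.differentiableAt_deriv ht)]

/-! ### Dynamic rays and the shift -/

theorem shift_iterate_apply (s : ℕ → ℤ) (k j : ℕ) : (shift^[k] s) j = s (k + j) := by
  induction k generalizing j with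
  | zero => rw [Function.iterate_zero_apply, zero_add]
  | succ k ih => rw [Function.iterate_succ_apply', shift, ih, add_right_comm, add_assoc]

theorem ExpBounded.shift {s : ℕ → ℤ} (hs : ExpBounded s) : ExpBounded (shift s) := by
  obtain ⟨x, hx, hbound⟩ := hs
  exact ⟨modelF x, hx.trans_le (le_modelF x), fun k => hbound (k + 1)⟩

theorem ExpBounded.exists_lt {s : ℕ → ℤ} (hs : ExpBounded s) {t : ℝ} (ht : minPotential s < t) :
    ∃ x, 0 < x ∧ x < t ∧ Tendsto (fun n : ℕ => |(s n : ℝ)| / modelF^[n] x) atTop (𝓝 0) := by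
  obtain ⟨x, hx, hbound⟩ := hs
  have hpos : ∀ n, 0 < modelF^[n] (2 * x) := fun n =>
    (mul_pos two_pos hx).trans_le (le_iterate_modelF n _)
  have hmem : 2 * x ∈ {x : ℝ | 0 < x ∧
      Tendsto (fun n : ℕ => |(s n : ℝ)| / modelF^[n] x) atTop (𝓝 0)} :=
    ⟨by positivity, squeeze_zero (fun n => div_nonneg (abs_nonneg _) (hpos n).le)
      (fun n => div_le_div_of_nonneg_right (hbound n) (hpos n).le)
      (tendsto_iterate_modelF_div hx (by linarith))⟩
  obtain ⟨y, ⟨hy, hlim⟩, hyt⟩ := exists_lt_of_csInf_lt ⟨_, hmem⟩ ht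
  exact ⟨y, hy, hyt, hlim⟩

theorem ExpBounded.pos_of_minPotential_lt {s : ℕ → ℤ} (hs : ExpBounded s) {t : ℝ}
    (ht : minPotential s < t) : 0 < t :=
  let ⟨_, hx, hxt, _⟩ := hs.exists_lt ht
  hx.trans hxt

theorem ExpBounded.minPotential_shift_lt {s : ℕ → ℤ} (hs : ExpBounded s) {t : ℝ}
    (ht : minPotential s < t) : minPotential (ExpRay.shift s) < modelF t := by
  obtain ⟨x, hx, hxt, hlim⟩ := hs.exists_lt ht
  have hle : minPotential (ExpRay.shift s) ≤ modelF x := csInf_le ⟨0, fun y hy => hy.1.le⟩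
    ⟨hx.trans_le (le_modelF x), hlim.comp (tendsto_add_atTop_nat 1)⟩
  exact hle.trans_lt (modelF_strictMono hxt)

theorem continuous_expMap (κ : ℂ) : Continuous (expMap κ) := by
  unfold expMap
  fun_prop

section Ray

variable {κ : ℂ} {s : ℕ → ℤ} {t₀ t₁ : ℝ} {g g' : ℝ → ℂ}

theorem IsDynRayOn.mono (h : IsDynRayOn κ s t₀ g) (hle : t₀ ≤ t₁) : IsDynRayOn κ s t₁ g where
  continuousOn := h.continuousOn.mono (Ici_subset_Ici.2 hle)
  tail := h.tail.mono fun _ hN t ht => hN t (hle.trans ht)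
  asymptotics := h.asymptotics

theorem IsDynRayOn.congr (h : IsDynRayOn κ s t₀ g) (hg : EqOn g' g (Ici t₀)) :
    IsDynRayOn κ s t₀ g' where
  continuousOn := h.continuousOn.congr hg
  tail := h.tail.mono fun N hN t ht => by rw [hg ht]; exact hN t ht
  asymptotics k := (h.asymptotics k).congr' <| by
    filter_upwards [eventually_ge_atTop t₀] with t ht
    rw [hg ht]

theorem IsDynRayOn.continuousOn_iterate (h : IsDynRayOn κ s t₀ g) (k : ℕ) :
    ContinuousOn (fun t => (expMap κ)^[k] (g t)) (Ici t₀) :=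
  ((continuous_expMap κ).iterate k).comp_continuousOn h.continuousOn

theorem IsDynRayOn.eqOn_iterate_of_succ (h : IsDynRayOn κ s t₀ g) (h' : IsDynRayOn κ s t₀ g')
    {k : ℕ} (hk : ∀ t ∈ Ici t₀, (expMap κ)^[k + 1] (g t) = (expMap κ)^[k + 1] (g' t)) :
    ∀ t ∈ Ici t₀, (expMap κ)^[k] (g t) = (expMap κ)^[k] (g' t) := by
  have hlift := eqOn_of_cexp_eq ((h.continuousOn_iterate k).add continuousOn_const)
    ((h'.continuousOn_iterate k).add continuousOn_const)
    (fun t ht => by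
      simpa only [Function.iterate_succ_apply', expMap, Pi.add_apply] using hk t ht)
    (by simpa using (h.asymptotics k).sub (h'.asymptotics k))
  exact fun t ht => add_right_cancel (hlift ht)

theorem IsDynRayOn.eqOn (h : IsDynRayOn κ s t₀ g) (h' : IsDynRayOn κ s t₀ g') :
    EqOn g g' (Ici t₀) := by
  obtain ⟨N, hN, hN'⟩ := (h.tail.and h'.tail).exists
  exact Nat.decreasingInduction (n := N)
    (motive := fun k _ => ∀ t ∈ Ici t₀, (expMap κ)^[k] (g t) = (expMap κ)^[k] (g' t))
    (fun k _ hk => h.eqOn_iterate_of_succ h' hk)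
    (fun t ht => tendsto_nhds_unique (hN t ht) (hN' t ht)) (Nat.zero_le N)

theorem RayDefinedAt.mono (h : RayDefinedAt κ s t₀) (hle : t₀ ≤ t₁) : RayDefinedAt κ s t₁ :=
  ⟨h.1.trans_le hle, h.2.imp fun _ hg => hg.mono hle⟩

theorem RayDefinedAt.isDynRayOn (h : RayDefinedAt κ s t₀) : IsDynRayOn κ s t₀ (dynRay κ s) := by
  have hg := h.2.choose_spec
  refine hg.congr fun t ht => ?_
  rw [dynRay, dif_pos (h.mono ht)]
  exact (h.mono ht).2.choose_spec.eqOn (hg.mono ht) self_mem_Ici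

theorem IsDynRayOn.shift (h : IsDynRayOn κ s t₀ g) :
    IsDynRayOn κ (shift s) (modelF t₀) (fun u => expMap κ (g (Real.log (u + 1)))) := by
  have hlog : ∀ {u}, modelF t₀ ≤ u → t₀ ≤ Real.log (u + 1) ∧ modelF (Real.log (u + 1)) = u := by
    intro u hu
    obtain ⟨t, ht, rfl⟩ := exists_modelF_eq hu
    rw [modelF_add_one, Real.log_exp]
    exact ⟨ht, rfl⟩
  refine ⟨?_, ?_, fun k => ?_⟩
  · refine (continuous_expMap κ).comp_continuousOn
      (h.continuousOn.comp (ContinuousOn.log (by fun_prop) fun u hu => ?_) fun u hu => (hlog hu).1)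
    rw [← (hlog hu).2, modelF_add_one]
    exact Real.exp_ne_zero _
  · filter_upwards [(tendsto_add_atTop_nat 1).eventually h.tail] with N hN u hu
    simpa only [Function.iterate_succ_apply, (hlog hu).2] using hN _ (hlog hu).1
  · have hlim : Tendsto (fun u : ℝ => Real.log (u + 1)) atTop atTop :=
      Real.tendsto_log_atTop.comp (tendsto_atTop_add_const_right _ _ tendsto_id)
    refine ((h.asymptotics (k + 1)).comp hlim).congr' ?_
    filter_upwards [eventually_ge_atTop (modelF t₀)] with u hu
    simp only [Function.comp_apply, Function.iterate_succ_apply, (hlog hu).2, ExpRay.shift]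

theorem RayDefinedAt.shift (hs : ExpBounded s) (h : RayDefinedAt κ s t₀) :
    RayDefinedAt κ (shift s) (modelF t₀) :=
  ⟨hs.minPotential_shift_lt h.1, _, h.isDynRayOn.shift⟩

theorem RayDefinedAt.dynRay_shift (hs : ExpBounded s) (h : RayDefinedAt κ s t₀) {t : ℝ}
    (ht : t₀ ≤ t) : dynRay κ (ExpRay.shift s) (modelF t) = expMap κ (dynRay κ s t) := by
  have heq := (h.shift hs).isDynRayOn.eqOn h.isDynRayOn.shift (modelF_strictMono.monotone ht)
  rwa [modelF_add_one, Real.log_exp] at heq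

theorem RayDefinedAt.iterate_shift (hs : ExpBounded s) (h : RayDefinedAt κ s t₀) (n : ℕ) :
    RayDefinedAt κ (ExpRay.shift^[n] s) (modelF^[n] t₀) := by
  induction n generalizing s t₀ with
  | zero => exact h
  | succ _ ih => exact ih hs.shift (h.shift hs)

theorem RayDefinedAt.dynRay_iterate_shift (hs : ExpBounded s) (h : RayDefinedAt κ s t₀) {t : ℝ}
    (ht : t₀ ≤ t) (n : ℕ) :
    dynRay κ (ExpRay.shift^[n] s) (modelF^[n] t) = (expMap κ)^[n] (dynRay κ s t) := by
  induction n generalizing s t₀ t with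
  | zero => rfl
  | succ n ih =>
    rw [Function.iterate_succ_apply, Function.iterate_succ_apply, Function.iterate_succ_apply,
      ih hs.shift (h.shift hs) (modelF_strictMono.monotone ht), h.dynRay_shift hs ht]

end Ray

/-! ### Limits and series of curves -/

theorem hasSum_half_pow_succ (k : ℕ) :
    HasSum (fun j : ℕ => (1 / 2 : ℝ) ^ (j + k + 1)) ((1 / 2) ^ k) := by
  have hscale : ∀ j : ℕ, (1 / 2 : ℝ) ^ k / 2 * (1 / 2) ^ j = (1 / 2) ^ (j + k + 1) := fun j => by
    ring
  simpa only [hscale, div_mul_cancel₀ _ (two_ne_zero' ℝ)] using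
    hasSum_geometric_two.mul_left ((1 / 2 : ℝ) ^ k / 2)

theorem tendsto_sum_range_of_dominated {E : Type*} [NormedAddCommGroup E] [CompleteSpace E]
    {f : ℕ → ℕ → E} {g : ℕ → E} {bound : ℕ → ℝ} (hbound : Summable bound)
    (hlim : ∀ j, Tendsto (fun m => f m j) atTop (𝓝 (g j)))
    (hle : ∀ m, ∀ j < m, ‖f m j‖ ≤ bound j) :
    Tendsto (fun m => ∑ j ∈ Finset.range m, f m j) atTop (𝓝 (∑' j, g j)) := by
  have htsum : ∀ m, ∑ j ∈ Finset.range m, f m j = ∑' j, if j < m then f m j else 0 := fun m => by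
    rw [tsum_eq_sum (s := Finset.range m) fun j hj => if_neg (by simpa using hj)]
    exact Finset.sum_congr rfl fun j hj => (if_pos (Finset.mem_range.1 hj)).symm
  simp_rw [htsum]
  refine tendsto_tsum_of_dominated_convergence hbound.abs
    (fun j => (hlim j).congr' ?_) (Eventually.of_forall fun m j => ?_)
  · filter_upwards [eventually_gt_atTop j] with m hm using (if_pos hm).symm
  · split_ifs with hj
    · exact (hle m j hj).trans (le_abs_self _)
    · rw [norm_zero]; exact abs_nonneg _

section Analysis

variable {E : Type*} [NormedAddCommGroup E] [NormedSpace ℝ E]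

theorem aestronglyMeasurable_restrict_of_hasDerivAt [CompleteSpace E] {f f' : ℝ → E} {S : Set ℝ}
    (hS : MeasurableSet S) (hf : ∀ u ∈ S, HasDerivAt f (f' u) u) :
    AEStronglyMeasurable f' (volume.restrict S) :=
  (stronglyMeasurable_deriv f).aestronglyMeasurable.congr <|
    (ae_restrict_mem hS).mono fun u hu => (hf u hu).deriv

theorem integral_eq_sub_of_hasDerivAt_of_norm_le [CompleteSpace E] {f f' : ℝ → E} {a b C : ℝ}
    (hf : ∀ u ∈ uIcc a b, HasDerivAt f (f' u) u) (hC : ∀ u ∈ uIcc a b, ‖f' u‖ ≤ C) :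
    ∫ u in a..b, f' u = f b - f a := by
  refine intervalIntegral.integral_eq_sub_of_hasDerivAt hf ?_
  refine (intervalIntegrable_const (c := C)).mono_fun
    (aestronglyMeasurable_restrict_of_hasDerivAt measurableSet_uIoc fun u hu =>
      hf u (uIoc_subset_uIcc hu)) ?_
  refine (ae_restrict_mem measurableSet_uIoc).mono fun u hu => ?_
  exact (hC u (uIoc_subset_uIcc hu)).trans (le_abs_self C)

theorem hasDerivAt_of_tendsto_of_norm_deriv_le [CompleteSpace E] {f f' : ℕ → ℝ → E} {g g' : ℝ → E}
    {t₀ t C : ℝ} (hf : ∀ n, ∀ u ∈ Ici t₀, HasDerivAt (f n) (f' n u) u)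
    (hC : ∀ n, ∀ u ∈ Ici t₀, ‖f' n u‖ ≤ C)
    (hg : ∀ u ∈ Ici t₀, Tendsto (fun n => f n u) atTop (𝓝 (g u)))
    (hg' : ∀ u ∈ Ici t₀, Tendsto (fun n => f' n u) atTop (𝓝 (g' u)))
    (hcont : ContinuousOn g' (Ici t₀)) (ht : t₀ < t) : HasDerivAt g (g' t) t := by
  have hsub : ∀ {u}, t₀ ≤ u → uIcc t₀ u ⊆ Ici t₀ := fun hu => by
    rw [uIcc_of_le hu]
    exact Icc_subset_Ici_self
  have hintegral : ∀ u, t₀ ≤ u → ∫ v in t₀..u, g' v = g u - g t₀ := by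
    intro u hu
    have hFTC := fun n => integral_eq_sub_of_hasDerivAt_of_norm_le
      (fun v hv => hf n v (hsub hu hv)) (fun v hv => hC n v (hsub hu hv))
    have hlim := intervalIntegral.tendsto_integral_filter_of_dominated_convergence (a := t₀)
      (b := u) (μ := volume) (F := f') (f := g') (fun _ => C)
      (Eventually.of_forall fun n => aestronglyMeasurable_restrict_of_hasDerivAt
        measurableSet_uIoc fun v hv => hf n v (hsub hu (uIoc_subset_uIcc hv)))
      (Eventually.of_forall fun n => Eventually.of_forall fun v hv =>
        hC n v (hsub hu (uIoc_subset_uIcc hv)))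
      intervalIntegrable_const
      (Eventually.of_forall fun v hv => hg' v (hsub hu (uIoc_subset_uIcc hv)))
    simp_rw [hFTC] at hlim
    exact tendsto_nhds_unique hlim ((hg u hu).sub (hg t₀ self_mem_Ici))
  have hderiv : HasDerivAt (fun u => ∫ v in t₀..u, g' v) (g' t) t :=
    intervalIntegral.integral_hasDerivAt_right (hcont.mono (hsub ht.le)).intervalIntegrable
      ((hcont.mono Ioi_subset_Ici_self).stronglyMeasurableAtFilter isOpen_Ioi t ht)
      (hcont.continuousAt (Ici_mem_nhds ht))
  refine (hderiv.add_const (g t₀)).congr_of_eventuallyEq ?_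
  filter_upwards [Ioi_mem_nhds ht] with u hu
  rw [hintegral u (le_of_lt hu), sub_add_cancel]

theorem contDiffOn_succ_of_hasDerivAt {f f' : ℝ → E} {U : Set ℝ} (hU : IsOpen U) {n : ℕ}
    (hf : ∀ t ∈ U, HasDerivAt f (f' t) t) (hf' : ContDiffOn ℝ n f' U) :
    ContDiffOn ℝ (n + 1) f U :=
  (contDiffOn_succ_iff_deriv_of_isOpen hU).2
    ⟨fun t ht => (hf t ht).differentiableAt.differentiableWithinAt,
      fun h => absurd h (WithTop.coe_ne_top), hf'.congr fun t ht => (hf t ht).deriv⟩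

end Analysis

theorem log_near_exp {R : ℂ} {t A : ℝ} (hR : ‖R - Real.exp t‖ ≤ A) (hA : 4 * A ≤ Real.exp t) :
    R ∈ Complex.slitPlane ∧ ‖Complex.log R - t‖ ≤ 2 * A * Real.exp (-t) := by
  have hexp : (Real.exp t : ℂ) ≠ 0 := Complex.ofReal_ne_zero.2 (Real.exp_ne_zero t)
  set q : ℂ := (R - Real.exp t) / Real.exp t with hq
  have hRq : R = Real.exp t * (1 + q) := by rw [hq]; field_simp; ring
  have hnorm : ‖q‖ ≤ A * Real.exp (-t) := by
    rw [hq, norm_div, Complex.norm_real, Real.norm_of_nonneg (Real.exp_pos t).le, Real.exp_neg,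
      ← div_eq_mul_inv]
    gcongr
  have hquarter : ‖q‖ ≤ 1 / 4 := hnorm.trans <| by
    rw [Real.exp_neg, ← div_eq_mul_inv, div_le_iff₀ (Real.exp_pos t)]
    linarith
  have hslit : 1 + q ∈ Complex.slitPlane :=
    Complex.mem_slitPlane_of_norm_lt_one (by linarith)
  refine ⟨?_, ?_⟩
  · rw [hRq, Complex.mem_slitPlane_iff, Complex.re_ofReal_mul, Complex.im_ofReal_mul]
    exact (Complex.mem_slitPlane_iff.1 hslit).imp (mul_pos (Real.exp_pos t))
      (mul_ne_zero (Real.exp_ne_zero t))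
  · rw [hRq, Complex.log_ofReal_mul (Real.exp_pos t) (Complex.slitPlane_ne_zero hslit),
      Real.log_exp, add_sub_cancel_left]
    linarith [Complex.norm_log_one_add_half_le_self (z := q) (by linarith), norm_nonneg q]

/-! ### Ray tails -/

/-- The quantity `‖κ‖ + 2π|j| + 2`, which bounds the distance of the inverse branch `L_{κ,j}` from
the real logarithm along ray tails. -/
def entrySize (κ : ℂ) (j : ℤ) : ℝ := ‖κ‖ + 2 * Real.pi * |(j : ℝ)| + 2

theorem entrySize_pos (κ : ℂ) (j : ℤ) : 0 < entrySize κ j := by unfold entrySize; positivity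

/-- The asymptotic line `t - κ + 2πi s₁` of the ray at address `s`. -/
def asymptote (κ : ℂ) (s : ℕ → ℤ) (t : ℝ) : ℂ := t - κ + 2 * Real.pi * Complex.I * (s 0 : ℂ)

theorem norm_asymptote_sub_le (κ : ℂ) (s : ℕ → ℤ) (t : ℝ) :
    ‖asymptote κ s t - t‖ ≤ entrySize κ (s 0) - 2 := by
  have hsub : asymptote κ s t - t = 2 * Real.pi * Complex.I * (s 0 : ℂ) - κ := by
    unfold asymptote; ring
  have hnorm : ‖2 * Real.pi * Complex.I * (s 0 : ℂ)‖ = 2 * Real.pi * |(s 0 : ℝ)| := by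
    simp [abs_of_pos Real.pi_pos]
  rw [hsub]
  refine (norm_sub_le _ _).trans ?_
  rw [hnorm, entrySize]
  linarith

theorem hasDerivAt_asymptote (κ : ℂ) (s : ℕ → ℤ) (t : ℝ) : HasDerivAt (asymptote κ s) 1 t :=
  (Complex.ofRealCLM.hasDerivAt.sub_const κ).add_const _

theorem continuous_asymptote (κ : ℂ) (s : ℕ → ℤ) : Continuous (asymptote κ s) := by
  unfold asymptote; fun_prop

/-- The entries of `s` are so small, relative to the orbit of any potential `t ≥ t₀`, that the
errors in the approximation of the ray at address `s` stay summable when multiplied by the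
derivatives of the iterates of `F`. -/
structure TailBound (κ : ℂ) (s : ℕ → ℤ) (t₀ : ℝ) : Prop where
  pos : 0 < t₀
  bound : ∀ (j : ℕ) (t : ℝ), t₀ ≤ t →
    4 * entrySize κ (s (j + 1)) * 2 ^ j * Real.exp (orbitSum j t) ≤ Real.exp (modelF^[j] t)

theorem ExpBounded.eventually_entrySize_le (κ : ℂ) {s : ℕ → ℤ} (hs : ExpBounded s) {t₀ : ℝ}
    (ht₀ : minPotential s < t₀) :
    ∀ᶠ n in atTop, entrySize κ (s (n + 1)) ≤ Real.exp (modelF^[n] t₀ / 2) := by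
  obtain ⟨x, hx, hxt, hlim⟩ := hs.exists_lt ht₀
  have hentry : ∀ᶠ n in atTop, |(s n : ℝ)| / modelF^[n] x < 1 / (4 * Real.pi) :=
    hlim.eventually_lt_const (by positivity)
  have hparam : ∀ᶠ n in atTop, 2 * (‖κ‖ + 2) ≤ modelF^[n] x :=
    (tendsto_iterate_modelF hx).eventually_ge_atTop _
  have horbit : ∀ᶠ n in atTop, modelF^[n] x / modelF^[n] t₀ < 1 / 2 :=
    (tendsto_iterate_modelF_div hx hxt).eventually_lt_const (by norm_num)
  filter_upwards [(tendsto_add_atTop_nat 1).eventually hentry,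
    (tendsto_add_atTop_nat 1).eventually hparam, horbit] with n hentry hparam horbit
  rw [div_lt_iff₀ (hx.trans_le (le_iterate_modelF _ _))] at hentry
  rw [div_lt_iff₀ ((hx.trans hxt).trans_le (le_iterate_modelF _ _))] at horbit
  calc entrySize κ (s (n + 1))
      ≤ ‖κ‖ + 2 * Real.pi * (1 / (4 * Real.pi) * modelF^[n + 1] x) + 2 := by
        unfold entrySize; gcongr
    _ = ‖κ‖ + 2 + modelF^[n + 1] x / 2 := by field_simp; ring
    _ ≤ modelF^[n + 1] x + 1 := by linarith
    _ = Real.exp (modelF^[n] x) := by rw [Function.iterate_succ_apply', modelF_add_one]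
    _ ≤ Real.exp (modelF^[n] t₀ / 2) := Real.exp_le_exp.2 (by linarith)

theorem ExpBounded.eventually_tailBound (κ : ℂ) {s : ℕ → ℤ} (hs : ExpBounded s) {t₀ : ℝ}
    (ht₀ : minPotential s < t₀) :
    ∀ᶠ K in atTop, TailBound κ (ExpRay.shift^[K] s) (modelF^[K] t₀) := by
  have hten : ∀ᶠ K in atTop, 10 ≤ modelF^[K] t₀ :=
    (tendsto_iterate_modelF (hs.pos_of_minPotential_lt ht₀)).eventually_ge_atTop _
  filter_upwards [hten, eventually_forall_ge_atTop.2 (hs.eventually_entrySize_le κ ht₀)]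
    with K hten hsize
  refine ⟨by linarith, fun j t ht => ?_⟩
  have horbit : modelF^[K + j] t₀ ≤ modelF^[j] t := by
    rw [add_comm, Function.iterate_add_apply]
    exact (strictMono_iterate_modelF j).monotone ht
  have hentry : entrySize κ (s (K + (j + 1))) ≤ Real.exp (modelF^[j] t / 2) :=
    (hsize (K + j) (Nat.le_add_right K j)).trans (Real.exp_le_exp.2 (by linarith))
  rw [shift_iterate_apply]
  calc 4 * entrySize κ (s (K + (j + 1))) * 2 ^ j * Real.exp (orbitSum j t)
      ≤ 4 * Real.exp (modelF^[j] t / 2) * 2 ^ j * Real.exp (orbitSum j t) := by gcongr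
    _ = 4 * 2 ^ j * Real.exp (orbitSum j t) * Real.exp (modelF^[j] t / 2) := by ring
    _ ≤ Real.exp (modelF^[j] t) := two_pow_mul_exp_orbitSum_le (hten.trans ht) j

/-- The deviation of the `m`-th approximation of the ray from its asymptotic line. -/
def approxErr (κ : ℂ) (m : ℕ) (s : ℕ → ℤ) (t : ℝ) : ℂ := rayApprox κ m s t - asymptote κ s t

theorem approxErr_succ (κ : ℂ) (m : ℕ) (s : ℕ → ℤ) (t : ℝ) :
    approxErr κ (m + 1) s t = Complex.log (rayApprox κ m (shift s) (modelF t)) - t := by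
  simp only [approxErr, asymptote, rayApprox, invBranch]
  ring

/-- The sum of the deviations met along the construction of the `m`-th approximation of the ray,
so that this approximation has the derivative `exp (-approxErrSum κ m s t)`. -/
def approxErrSum (κ : ℂ) (m : ℕ) (s : ℕ → ℤ) (t : ℝ) : ℂ :=
  ∑ j ∈ Finset.range m, approxErr κ (m - j) (shift^[j] s) (modelF^[j] t)

theorem approxErrSum_succ (κ : ℂ) (m : ℕ) (s : ℕ → ℤ) (t : ℝ) :
    approxErrSum κ (m + 1) s t =
      approxErrSum κ m (shift s) (modelF t) + approxErr κ (m + 1) s t := by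
  simp only [approxErrSum, Finset.sum_range_succ', Nat.add_sub_add_right,
    Function.iterate_succ_apply, Nat.sub_zero, Function.iterate_zero_apply]

namespace TailBound

variable {κ : ℂ} {s : ℕ → ℤ} {t₀ t : ℝ}

theorem shift (h : TailBound κ s t₀) : TailBound κ (shift s) (modelF t₀) := by
  refine ⟨h.pos.trans_le (le_modelF _), fun j u hu => ?_⟩
  obtain ⟨t, ht, rfl⟩ := exists_modelF_eq hu
  have hpos := entrySize_pos κ (s (j + 1 + 1))
  refine le_trans ?_ (h.bound (j + 1) t ht)
  simp only [ExpRay.shift]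
  gcongr
  · norm_num
  · exact j.le_succ
  · rw [orbitSum_succ']
    exact le_add_of_nonneg_right (h.pos.le.trans ht)

theorem iterate_shift (h : TailBound κ s t₀) (n : ℕ) :
    TailBound κ (ExpRay.shift^[n] s) (modelF^[n] t₀) := by
  induction n generalizing s t₀ with
  | zero => exact h
  | succ _ ih => exact ih h.shift

theorem four_mul_entrySize_le (h : TailBound κ s t₀) (ht : t₀ ≤ t) :
    4 * entrySize κ (s 1) ≤ Real.exp t := by
  simpa using h.bound 0 t ht

theorem norm_rayApprox_sub_le (h : TailBound κ s t₀) (ht : t₀ ≤ t) (m : ℕ) :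
    ‖rayApprox κ m s t - (t + 1)‖ ≤ entrySize κ (s 0) := by
  induction m generalizing s t₀ t with
  | zero =>
    rw [rayApprox, sub_add_cancel_left, norm_neg, norm_one, entrySize]
    nlinarith [norm_nonneg κ, abs_nonneg (s 0 : ℝ), Real.pi_pos]
  | succ m ih =>
    have hshift : ‖rayApprox κ m (ExpRay.shift s) (modelF t) - Real.exp t‖ ≤ entrySize κ (s 1) := by
      rw [← modelF_add_one, Complex.ofReal_add, Complex.ofReal_one]
      exact ih h.shift (modelF_strictMono.monotone ht)
    have hlog := (log_near_exp hshift (h.four_mul_entrySize_le ht)).2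
    rw [← approxErr_succ, Real.exp_neg, ← div_eq_mul_inv] at hlog
    have herr : ‖approxErr κ (m + 1) s t‖ ≤ 1 := hlog.trans <| by
      rw [div_le_one (Real.exp_pos t)]
      linarith [h.four_mul_entrySize_le ht, entrySize_pos κ (s 1)]
    calc ‖rayApprox κ (m + 1) s t - (t + 1)‖
        = ‖approxErr κ (m + 1) s t + (asymptote κ s t - t) - 1‖ := by unfold approxErr; ring_nf
      _ ≤ ‖approxErr κ (m + 1) s t‖ + ‖asymptote κ s t - t‖ + ‖(1 : ℂ)‖ :=
        (norm_sub_le _ _).trans (by gcongr; exact norm_add_le _ _)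
      _ ≤ entrySize κ (s 0) := by
        rw [norm_one]
        linarith [norm_asymptote_sub_le κ s t]

theorem norm_rayApprox_shift_sub_exp_le (h : TailBound κ s t₀) (ht : t₀ ≤ t) (m : ℕ) :
    ‖rayApprox κ m (ExpRay.shift s) (modelF t) - Real.exp t‖ ≤ entrySize κ (s 1) := by
  rw [← modelF_add_one, Complex.ofReal_add, Complex.ofReal_one]
  exact h.shift.norm_rayApprox_sub_le (modelF_strictMono.monotone ht) m

theorem rayApprox_shift_mem_slitPlane (h : TailBound κ s t₀) (ht : t₀ ≤ t) (m : ℕ) :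
    rayApprox κ m (ExpRay.shift s) (modelF t) ∈ Complex.slitPlane :=
  (log_near_exp (h.norm_rayApprox_shift_sub_exp_le ht m) (h.four_mul_entrySize_le ht)).1

theorem norm_approxErr_succ_le (h : TailBound κ s t₀) (ht : t₀ ≤ t) (m : ℕ) :
    ‖approxErr κ (m + 1) s t‖ ≤ 2 * entrySize κ (s 1) * Real.exp (-t) :=
  approxErr_succ κ m s t ▸
    (log_near_exp (h.norm_rayApprox_shift_sub_exp_le ht m) (h.four_mul_entrySize_le ht)).2

theorem norm_approxErr_iterate_le (h : TailBound κ s t₀) (ht : t₀ ≤ t) {m j : ℕ} (hj : j < m) :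
    ‖approxErr κ (m - j) (ExpRay.shift^[j] s) (modelF^[j] t)‖ ≤
      (1 / 2) ^ (j + 1) * Real.exp (-orbitSum j t) := by
  obtain ⟨d, hd⟩ := Nat.exists_eq_succ_of_ne_zero (Nat.sub_ne_zero_of_lt hj)
  have herr := (h.iterate_shift j).norm_approxErr_succ_le
    ((strictMono_iterate_modelF j).monotone ht) d
  rw [shift_iterate_apply] at herr
  rw [hd]
  refine herr.trans ?_
  rw [Real.exp_neg, Real.exp_neg, ← div_eq_mul_inv, ← div_eq_mul_inv,
    div_le_div_iff₀ (Real.exp_pos _) (Real.exp_pos _)]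
  calc 2 * entrySize κ (s (j + 1)) * Real.exp (orbitSum j t)
      = (1 / 2) ^ (j + 1) *
          (4 * entrySize κ (s (j + 1)) * 2 ^ j * Real.exp (orbitSum j t)) := by
        rw [one_div, inv_pow, pow_succ]; field_simp; ring
    _ ≤ (1 / 2) ^ (j + 1) * Real.exp (modelF^[j] t) := by gcongr; exact h.bound j t ht

theorem norm_approxErr_iterate_le_pow (h : TailBound κ s t₀) (ht : t₀ ≤ t) {m j : ℕ}
    (hj : j < m) :
    ‖approxErr κ (m - j) (ExpRay.shift^[j] s) (modelF^[j] t)‖ ≤ (1 / 2) ^ (j + 1) :=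
  (h.norm_approxErr_iterate_le ht hj).trans <| mul_le_of_le_one_right (by positivity)
    (exp_neg_orbitSum_le_one (h.pos.le.trans ht) j)

theorem norm_approxErrSum_le (h : TailBound κ s t₀) (ht : t₀ ≤ t) (m : ℕ) :
    ‖approxErrSum κ m s t‖ ≤ 1 :=
  calc ‖approxErrSum κ m s t‖ ≤ ∑ j ∈ Finset.range m, (1 / 2 : ℝ) ^ (j + 1) :=
        norm_sum_le_of_le _ fun _ hj => h.norm_approxErr_iterate_le_pow ht (Finset.mem_range.1 hj)
    _ ≤ 1 := sum_le_hasSum _ (fun _ _ => by positivity) (hasSum_half_pow_succ 0)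

theorem hasDerivAt_rayApprox (h : TailBound κ s t₀) (ht : t₀ ≤ t) (m : ℕ) :
    HasDerivAt (rayApprox κ m s) (Complex.exp (-approxErrSum κ m s t)) t := by
  induction m generalizing s t₀ t with
  | zero =>
    simp only [approxErrSum, Finset.range_zero, Finset.sum_empty, neg_zero, Complex.exp_zero]
    exact Complex.ofRealCLM.hasDerivAt
  | succ m ih =>
    have hslit := h.rayApprox_shift_mem_slitPlane ht m
    have hexp : rayApprox κ m (ExpRay.shift s) (modelF t) =
        Complex.exp (approxErr κ (m + 1) s t) * Complex.exp t := by
      rw [← Complex.exp_add, approxErr_succ, sub_add_cancel,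
        Complex.exp_log (Complex.slitPlane_ne_zero hslit)]
    have hinner := (ih h.shift (modelF_strictMono.monotone ht)).scomp t (hasDerivAt_modelF t)
    refine (((hinner.clog_real hslit).sub_const κ).add_const
      (2 * Real.pi * Complex.I * (s 0 : ℂ))).congr_deriv ?_
    rw [Function.comp_apply, hexp, approxErrSum_succ, neg_add, Complex.exp_add, Complex.real_smul,
      Complex.ofReal_exp, Complex.exp_neg (approxErr κ (m + 1) s t)]
    field_simp

end TailBound

/-- On `[t₀, ∞)` the ray at address `s` is a tail, together with its images at the addresses
`σ^k s`: all of them are limits of the approximations defining ray tails, with summable errors. -/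
structure IsRayTail (κ : ℂ) (s : ℕ → ℤ) (t₀ : ℝ) : Prop where
  tailBound : TailBound κ s t₀
  tendsto : ∀ k, ∀ t ∈ Ici t₀,
    Tendsto (fun n => rayApprox κ n (shift^[k] s) (modelF^[k] t)) atTop
      (𝓝 (dynRay κ (shift^[k] s) (modelF^[k] t)))
  continuousOn : ∀ k, ContinuousOn (dynRay κ (shift^[k] s)) (Ici (modelF^[k] t₀))

/-- The deviation of the ray from its asymptotic line. -/
def tailErr (κ : ℂ) (s : ℕ → ℤ) (t : ℝ) : ℂ := dynRay κ s t - asymptote κ s t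

/-- The sum of the deviations of the rays at the addresses `σ^j s` from their asymptotic lines, so
that a ray tail has the derivative `exp (-logSum κ s t)`. -/
def logSum (κ : ℂ) (s : ℕ → ℤ) (t : ℝ) : ℂ := ∑' j, tailErr κ (shift^[j] s) (modelF^[j] t)

/-- The derivative of the `k`-th term of `logSum κ s` at `t`. -/
def tailErrDeriv (κ : ℂ) (s : ℕ → ℤ) (k : ℕ) (t : ℝ) : ℂ :=
  Real.exp (orbitSum k t) • (Complex.exp (-logSum κ (shift^[k] s) (modelF^[k] t)) - 1)

namespace IsRayTail

variable {κ : ℂ} {s : ℕ → ℤ} {t₀ t : ℝ}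

theorem shift (h : IsRayTail κ s t₀) : IsRayTail κ (shift s) (modelF t₀) where
  tailBound := h.tailBound.shift
  tendsto k u hu := by
    obtain ⟨t, ht, rfl⟩ := exists_modelF_eq hu
    exact h.tendsto (k + 1) t ht
  continuousOn k := h.continuousOn (k + 1)

theorem iterate_shift (h : IsRayTail κ s t₀) (n : ℕ) :
    IsRayTail κ (ExpRay.shift^[n] s) (modelF^[n] t₀) := by
  induction n generalizing s t₀ with
  | zero => exact h
  | succ _ ih => exact ih h.shift

theorem tendsto_approxErr (h : IsRayTail κ s t₀) (ht : t₀ ≤ t) (j : ℕ) :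
    Tendsto (fun m => approxErr κ (m - j) (ExpRay.shift^[j] s) (modelF^[j] t)) atTop
      (𝓝 (tailErr κ (ExpRay.shift^[j] s) (modelF^[j] t))) :=
  ((h.tendsto j t ht).sub_const _).comp (tendsto_sub_atTop_nat j)

theorem norm_tailErr_le (h : IsRayTail κ s t₀) (ht : t₀ ≤ t) (j : ℕ) :
    ‖tailErr κ (ExpRay.shift^[j] s) (modelF^[j] t)‖ ≤
      (1 / 2) ^ (j + 1) * Real.exp (-orbitSum j t) :=
  le_of_tendsto (h.tendsto_approxErr ht j).norm <|
    (eventually_gt_atTop j).mono fun _ hm => h.tailBound.norm_approxErr_iterate_le ht hm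

theorem norm_tailErr_le_pow (h : IsRayTail κ s t₀) (ht : t₀ ≤ t) (j : ℕ) :
    ‖tailErr κ (ExpRay.shift^[j] s) (modelF^[j] t)‖ ≤ (1 / 2) ^ (j + 1) :=
  (h.norm_tailErr_le ht j).trans <| mul_le_of_le_one_right (by positivity)
    (exp_neg_orbitSum_le_one (h.tailBound.pos.le.trans ht) j)

theorem summable_tailErr (h : IsRayTail κ s t₀) (ht : t₀ ≤ t) :
    Summable fun j => tailErr κ (ExpRay.shift^[j] s) (modelF^[j] t) :=
  (hasSum_half_pow_succ 0).summable.of_norm_bounded (h.norm_tailErr_le_pow ht)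

theorem continuousOn_tailErr (h : IsRayTail κ s t₀) (j : ℕ) :
    ContinuousOn (fun t => tailErr κ (ExpRay.shift^[j] s) (modelF^[j] t)) (Ici t₀) :=
  ((h.continuousOn j).sub (continuous_asymptote κ _).continuousOn).comp
    (continuous_iterate_modelF j).continuousOn fun _ ht => (strictMono_iterate_modelF j).monotone ht

theorem continuousOn_logSum (h : IsRayTail κ s t₀) : ContinuousOn (logSum κ s) (Ici t₀) :=
  continuousOn_tsum h.continuousOn_tailErr (hasSum_half_pow_succ 0).summable
    fun j _ ht => h.norm_tailErr_le_pow ht j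

theorem tendsto_approxErrSum (h : IsRayTail κ s t₀) (ht : t₀ ≤ t) :
    Tendsto (fun m => approxErrSum κ m s t) atTop (𝓝 (logSum κ s t)) :=
  tendsto_sum_range_of_dominated (hasSum_half_pow_succ 0).summable (h.tendsto_approxErr ht)
    fun _ _ hj => h.tailBound.norm_approxErr_iterate_le_pow ht hj

theorem hasDerivAt_dynRay (h : IsRayTail κ s t₀) (ht : t₀ < t) :
    HasDerivAt (dynRay κ s) (Complex.exp (-logSum κ s t)) t :=
  hasDerivAt_of_tendsto_of_norm_deriv_le (C := Real.exp 1)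
    (fun m _ hu => h.tailBound.hasDerivAt_rayApprox hu m)
    (fun m _ hu => (Complex.norm_exp_le_exp_norm _).trans <| Real.exp_le_exp.2 <|
      (norm_neg _).trans_le (h.tailBound.norm_approxErrSum_le hu m))
    (h.tendsto 0)
    (fun _ hu => (Complex.continuous_exp.tendsto _).comp (h.tendsto_approxErrSum hu).neg)
    (Complex.continuous_exp.comp_continuousOn h.continuousOn_logSum.neg) ht

theorem norm_logSum_le (h : IsRayTail κ s t₀) (ht : t₀ ≤ t) (k : ℕ) :
    ‖logSum κ (ExpRay.shift^[k] s) (modelF^[k] t)‖ ≤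
      (1 / 2) ^ k * Real.exp (-orbitSum k t) := by
  refine tsum_of_norm_bounded ((hasSum_half_pow_succ k).mul_right _) fun j => ?_
  rw [← Function.iterate_add_apply, ← Function.iterate_add_apply]
  refine (h.norm_tailErr_le ht (j + k)).trans ?_
  have hmono := monotone_orbitSum (h.tailBound.pos.le.trans ht) (Nat.le_add_left k j)
  gcongr

theorem norm_tailErrDeriv_le (h : IsRayTail κ s t₀) (ht : t₀ ≤ t) (k : ℕ) :
    ‖tailErrDeriv κ s k t‖ ≤ 2 * (1 / 2) ^ k := by
  set L := logSum κ (ExpRay.shift^[k] s) (modelF^[k] t) with hL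
  have hle : ‖-L‖ ≤ (1 / 2) ^ k * Real.exp (-orbitSum k t) :=
    (norm_neg L).trans_le (h.norm_logSum_le ht k)
  have hone : ‖-L‖ ≤ 1 := hle.trans <| mul_le_one₀ (pow_le_one₀ (by norm_num) (by norm_num))
    (Real.exp_pos _).le (exp_neg_orbitSum_le_one (h.tailBound.pos.le.trans ht) k)
  rw [tailErrDeriv, ← hL, norm_smul, Real.norm_of_nonneg (Real.exp_pos _).le]
  calc Real.exp (orbitSum k t) * ‖Complex.exp (-L) - 1‖
      ≤ Real.exp (orbitSum k t) * (2 * ((1 / 2) ^ k * Real.exp (-orbitSum k t))) := by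
        gcongr
        exact (Complex.norm_exp_sub_one_le hone).trans (by gcongr)
    _ = 2 * (1 / 2) ^ k := by rw [Real.exp_neg]; field_simp

theorem hasDerivAt_tailErr (h : IsRayTail κ s t₀) (ht : t₀ < t) (k : ℕ) :
    HasDerivAt (fun t => tailErr κ (ExpRay.shift^[k] s) (modelF^[k] t)) (tailErrDeriv κ s k t) t :=
  (((h.iterate_shift k).hasDerivAt_dynRay (strictMono_iterate_modelF k ht)).sub
    (hasDerivAt_asymptote κ _ _)).scomp t (hasDerivAt_iterate_modelF k t)

theorem continuousOn_tailErrDeriv (h : IsRayTail κ s t₀) (k : ℕ) :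
    ContinuousOn (tailErrDeriv κ s k) (Ici t₀) := by
  have hlogSum : ContinuousOn (fun t => logSum κ (ExpRay.shift^[k] s) (modelF^[k] t)) (Ici t₀) :=
    (h.iterate_shift k).continuousOn_logSum.comp (continuous_iterate_modelF k).continuousOn
      fun _ ht => (strictMono_iterate_modelF k).monotone ht
  exact (Real.continuous_exp.comp (continuous_orbitSum k)).continuousOn.smul
    ((Complex.continuous_exp.comp_continuousOn hlogSum.neg).sub continuousOn_const)

theorem hasDerivAt_logSum (h : IsRayTail κ s t₀) (ht : t₀ < t) :
    HasDerivAt (logSum κ s) (∑' k, tailErrDeriv κ s k t) t :=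
  hasDerivAt_tsum_of_isPreconnected (summable_geometric_two.mul_left 2) isOpen_Ioi
    isPreconnected_Ioi (fun k _ hu => h.hasDerivAt_tailErr hu k)
    (fun k _ hu => h.norm_tailErrDeriv_le (le_of_lt hu) k) ht (h.summable_tailErr ht.le) ht

theorem contDiffOn_logSum (h : IsRayTail κ s t₀) : ContDiffOn ℝ 1 (logSum κ s) (Ioi t₀) := by
  have hcont : ContinuousOn (fun t => ∑' k, tailErrDeriv κ s k t) (Ici t₀) :=
    continuousOn_tsum h.continuousOn_tailErrDeriv (summable_geometric_two.mul_left 2)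
      fun k _ ht => h.norm_tailErrDeriv_le ht k
  exact contDiffOn_succ_of_hasDerivAt (n := 0) isOpen_Ioi (fun _ ht => h.hasDerivAt_logSum ht)
    (contDiffOn_zero.2 (hcont.mono Ioi_subset_Ici_self))

theorem isRegularCurve (h : IsRayTail κ s t₀) : IsRegularCurve (dynRay κ s) t₀ where
  contDiffOn := contDiffOn_succ_of_hasDerivAt (n := 1) isOpen_Ioi
    (fun _ ht => h.hasDerivAt_dynRay ht) h.contDiffOn_logSum.neg.cexp
  deriv_ne_zero _ ht := (h.hasDerivAt_dynRay ht).deriv.trans_ne (Complex.exp_ne_zero _)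

end IsRayTail

/-! ### Regularity and variation number of dynamic rays -/

section RayCurve

variable {κ : ℂ} {s : ℕ → ℤ} {t₀ t : ℝ}

theorem IsRayTail.dynRay_ne (h : IsRayTail κ s t₀) (ht : 1 < t - t₀) :
    dynRay κ s t ≠ dynRay κ s t₀ := by
  intro heq
  have hsub : tailErr κ s t₀ - tailErr κ s t = ((t - t₀ : ℝ) : ℂ) := by
    simp only [tailErr, asymptote, heq, Complex.ofReal_sub]
    ring
  have hle := norm_sub_le_of_le (h.norm_tailErr_le_pow le_rfl 0)
    (h.norm_tailErr_le_pow (show t₀ ≤ t by linarith) 0)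
  simp only [Function.iterate_zero_apply, hsub, Complex.norm_real, Real.norm_eq_abs] at hle
  linarith [le_abs_self (t - t₀)]

theorem RayDefinedAt.eventually_isRayTail (hs : ExpBounded s) (h : RayDefinedAt κ s t₀) :
    ∀ᶠ K in atTop, IsRayTail κ (ExpRay.shift^[K] s) (modelF^[K] t₀) := by
  filter_upwards [hs.eventually_tailBound κ h.1, eventually_forall_ge_atTop.2 h.isDynRayOn.tail]
    with K hbound htail
  refine ⟨hbound, fun k u hu => ?_, fun k => ?_⟩
  · obtain ⟨t, ht, rfl⟩ := exists_iterate_modelF_eq hu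
    simpa only [← Function.iterate_add_apply, h.dynRay_iterate_shift hs ht] using
      htail (k + K) (Nat.le_add_left K k) t ht
  · simpa only [← Function.iterate_add_apply] using
      (h.iterate_shift hs (k + K)).isDynRayOn.continuousOn

theorem RayDefinedAt.dynRay_ne (hs : ExpBounded s) (h : RayDefinedAt κ s t₀) (ht : t₀ < t) :
    dynRay κ s t ≠ dynRay κ s t₀ := by
  intro heq
  have hlim := tendsto_iterate_modelF_sub (hs.pos_of_minPotential_lt h.1) ht
  obtain ⟨K, hK, hK1⟩ := ((h.eventually_isRayTail hs).and (hlim.eventually_gt_atTop 1)).exists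
  apply hK.dynRay_ne hK1
  rw [h.dynRay_iterate_shift hs ht.le, h.dynRay_iterate_shift hs le_rfl, heq]

theorem RayDefinedAt.injOn (hs : ExpBounded s) (h : RayDefinedAt κ s t₀) :
    InjOn (dynRay κ s) (Ici t₀) := fun _ ht _ hu heq =>
  le_antisymm (not_lt.1 fun hlt => (h.mono hu).dynRay_ne hs hlt heq)
    (not_lt.1 fun hlt => (h.mono ht).dynRay_ne hs hlt heq.symm)

theorem RayDefinedAt.eqOn_cexp (hs : ExpBounded s) (h : RayDefinedAt κ s t₀) :
    EqOn (fun t => Complex.exp (dynRay κ s t + κ))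
      (fun t => dynRay κ (ExpRay.shift s) (modelF t)) (Ioi t₀) :=
  fun _ ht => (h.dynRay_shift hs (le_of_lt ht)).symm

theorem RayDefinedAt.isRegularCurve_add_const_of_shift (hs : ExpBounded s)
    (h : RayDefinedAt κ s t₀) (hreg : IsRegularCurve (dynRay κ (ExpRay.shift s)) (modelF t₀)) :
    IsRegularCurve (fun t => dynRay κ s t + κ) t₀ :=
  .of_cexp ((h.isDynRayOn.continuousOn.mono Ioi_subset_Ici_self).add continuousOn_const)
    (hreg.comp_modelF.congr (h.eqOn_cexp hs))

theorem RayDefinedAt.isRegularCurve (hs : ExpBounded s) (h : RayDefinedAt κ s t₀) :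
    IsRegularCurve (dynRay κ s) t₀ := by
  obtain ⟨K, hK⟩ := (h.eventually_isRayTail hs).exists
  induction K generalizing s t₀ with
  | zero => exact hK.isRegularCurve
  | succ K ih =>
    have hreg := h.isRegularCurve_add_const_of_shift hs (ih hs.shift (h.shift hs) hK)
    simpa only [add_sub_cancel_right] using hreg.sub_const κ

theorem RayDefinedAt.argVariation_deriv_le (hs : ExpBounded s) (h : RayDefinedAt κ s t₀) :
    argVariation (deriv (dynRay κ s)) t₀ ≤
      2 * argVariation (deriv (dynRay κ (ExpRay.shift s))) (modelF t₀) +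
        ENNReal.ofReal Real.pi := by
  have hreg := (h.shift hs).isRegularCurve hs.shift
  have hcexp : argVariation (deriv fun t => Complex.exp (dynRay κ s t + κ)) t₀ =
      argVariation (deriv (dynRay κ (ExpRay.shift s))) (modelF t₀) :=
    (argVariation_congr ((h.eqOn_cexp hs).deriv isOpen_Ioi)).trans
      hreg.argVariation_deriv_comp_modelF
  simpa only [hcexp, deriv_add_const'] using
    (h.isRegularCurve_add_const_of_shift hs hreg).argVariation_deriv_le

theorem RayDefinedAt.argVariation_deriv_add_pi_le (hs : ExpBounded s) (h : RayDefinedAt κ s t₀)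
    (N : ℕ) :
    argVariation (deriv (dynRay κ s)) t₀ + ENNReal.ofReal Real.pi ≤
      2 ^ N * (argVariation (deriv (dynRay κ (ExpRay.shift^[N] s))) (modelF^[N] t₀) +
        ENNReal.ofReal Real.pi) := by
  induction N generalizing s t₀ with
  | zero => simp
  | succ N ih =>
    calc argVariation (deriv (dynRay κ s)) t₀ + ENNReal.ofReal Real.pi
        ≤ 2 * argVariation (deriv (dynRay κ (ExpRay.shift s))) (modelF t₀) +
            ENNReal.ofReal Real.pi + ENNReal.ofReal Real.pi := by
          gcongr
          exact h.argVariation_deriv_le hs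
      _ = 2 * (argVariation (deriv (dynRay κ (ExpRay.shift s))) (modelF t₀) +
            ENNReal.ofReal Real.pi) := by ring
      _ ≤ 2 * (2 ^ N * (argVariation (deriv (dynRay κ (ExpRay.shift^[N + 1] s)))
            (modelF^[N + 1] t₀) + ENNReal.ofReal Real.pi)) := by
          gcongr
          exact ih hs.shift (h.shift hs)
      _ = _ := by rw [pow_succ', mul_assoc]

end RayCurve

theorem lintegral_exp_neg_div_two_le {t₀ : ℝ} (ht₀ : 0 ≤ t₀) :
    ∫⁻ t in Ioi t₀, ENNReal.ofReal (Real.exp (-t / 2)) ≤ ENNReal.ofReal 2 := by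
  have hexp : ∀ t : ℝ, Real.exp (-t / 2) = Real.exp (-(1 / 2) * t) := fun t => by ring_nf
  simp only [hexp]
  rw [← ofReal_integral_eq_lintegral_ofReal (integrableOn_exp_mul_Ioi (by norm_num) t₀)
    (Eventually.of_forall fun _ => (Real.exp_pos _).le), integral_exp_mul_Ioi (by norm_num)]
  refine ENNReal.ofReal_le_ofReal ?_
  have hone : Real.exp (-(1 / 2) * t₀) ≤ 1 := Real.exp_le_one_iff.2 (by linarith)
  linarith

theorem argVariation_le_pi_of_norm_logDeriv_le {γ : ℝ → ℂ} {t₀ : ℝ} (ht₀ : 0 ≤ t₀)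
    (h : ∀ t ∈ Ioi t₀, ‖logDeriv γ t‖ ≤ Real.exp (-t / 2)) :
    argVariation γ t₀ ≤ ENNReal.ofReal Real.pi :=
  calc argVariation γ t₀ ≤ ∫⁻ t in Ioi t₀, ENNReal.ofReal (Real.exp (-t / 2)) :=
        setLIntegral_mono' measurableSet_Ioi fun t ht =>
          ENNReal.ofReal_le_ofReal ((Complex.abs_im_le_norm _).trans (h t ht))
    _ ≤ ENNReal.ofReal 2 := lintegral_exp_neg_div_two_le ht₀
    _ ≤ ENNReal.ofReal Real.pi := ENNReal.ofReal_le_ofReal Real.two_le_pi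

theorem RayDefinedAt.variationNumber_le {κ : ℂ} {s : ℕ → ℤ} {t₀ : ℝ} (hs : ExpBounded s)
    (h : RayDefinedAt κ s t₀) {a : ℂ} (ha : a ∉ dynRay κ s '' Ioi t₀) (N : ℕ) :
    variationNumber (dynRay κ s) t₀ a ≤
      2 ^ N * (argVariation (deriv (dynRay κ (ExpRay.shift^[N] s))) (modelF^[N] t₀) +
        ENNReal.ofReal Real.pi) / ENNReal.ofReal (2 * Real.pi) := by
  rw [variationNumber_eq]
  exact ENNReal.div_le_div_right (((h.isRegularCurve hs).argVariation_sub_const_le ha).trans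
    (h.argVariation_deriv_add_pi_le hs N)) _

theorem proposition4p12_general {κ : ℂ} {s : ℕ → ℤ} {t₀ : ℝ} (hs : ExpBounded s)
    (h : RayDefinedAt κ s t₀) :
    ContDiffOn ℝ 2 (dynRay κ s) (Ioi t₀) ∧ InjOn (dynRay κ s) (Ici t₀) ∧
      ∀ a ∉ dynRay κ s '' Ioi t₀, ∀ N,
        argVariation (deriv (dynRay κ (shift^[N] s))) (modelF^[N] t₀) ≤ ENNReal.ofReal Real.pi →
          variationNumber (dynRay κ s) t₀ a ≤ 2 ^ N := by
  refine ⟨(h.isRegularCurve hs).contDiffOn, h.injOn hs, fun a ha N hle => ?_⟩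
  refine (h.variationNumber_le hs ha N).trans (ENNReal.div_le_of_le_mul ?_)
  rw [two_mul Real.pi, ENNReal.ofReal_add Real.pi_pos.le Real.pi_pos.le]
  gcongr

end ExpRay

end

theorem proposition4p12 (κ : ℂ) (s : ℕ → ℤ) (hs : ExpRay.ExpBounded s)
    (t₀ : ℝ) (ht₀ : ExpRay.RayDefinedAt κ s t₀)
    (z : ℂ) (hz : z = ExpRay.dynRay κ s t₀) (N : ℕ)
    (hN : ∀ t : ℝ, ExpRay.modelF^[N] t₀ ≤ t →
      ‖deriv (deriv (ExpRay.dynRay κ (ExpRay.shift^[N] s))) t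
        / deriv (ExpRay.dynRay κ (ExpRay.shift^[N] s)) t‖ < Real.exp (-t / 2)) :
    ContDiffOn ℝ 1 (ExpRay.dynRay κ s) (Set.Ioi t₀) ∧
    z ∉ ExpRay.dynRay κ s '' Set.Ioi t₀ ∧
    ExpRay.variationNumber (ExpRay.dynRay κ s) t₀ z ≤ 2 ^ N := by
  obtain ⟨hdiff, hinj, hvar⟩ := ExpRay.proposition4p12_general hs ht₀
  have hz' : z ∉ ExpRay.dynRay κ s '' Ioi t₀ := fun ⟨_, ht, htz⟩ =>
    (ne_of_gt ht) (hinj (Ioi_subset_Ici_self ht) self_mem_Ici (htz.trans hz))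
  have hpos := (hs.pos_of_minPotential_lt ht₀.1).le.trans (ExpRay.le_iterate_modelF N t₀)
  exact ⟨hdiff.of_le one_le_two, hz', hvar z hz' N <|
    ExpRay.argVariation_le_pi_of_norm_logDeriv_le hpos fun t ht => (hN t ht.le).le⟩
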